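/- **Setting.** BDDs are reduced ordered binary decision diagrams without complemented edges, kept in one shared store: a *unique table* containing each decision node (variable, low-successor, high-successor) at most once, and a *computed table* of the operator $\mathrm{ite}(F,G,H)=F\cdot G+\overline{F}\cdot H$. A call $\mathrm{ite}(F,G,H)$ returns at once in a terminal case ($F$ constant, $G=H$, or $G=1,H=0$) or if $(F,G,H)$ is in the computed table. Otherwise it takes the top variable $x$ of $F,G,H$, calls itself on the cofactors to $x=1$ and to $x=0$ with results $R_h$ and $R_l$, returns $R_h$ if $R_h=R_l$, and else finds or adds the node $(x,R_l,R_h)$ in the unique table, enters it for $(F,G,H)$ in the computed table and returns it. Both tables are initially empty. *Time* is the number of elementary steps, where every search in a table is charged the full current length of that table (no assumption on hashing is made). *Space* is the number of table entries, of stored references for the signals, and of places on the recursion stack. *Symbolic simulation* of a circuit processes the gates in topological order and computes for each signal its BDD from those of the gate inputs: $x\wedge y$ as $\mathrm{ite}(x,y,0)$, $x\vee y$ as $\mathrm{ite}(x,1,y)$, $x\oplus y$ as $\mathrm{ite}(x,\mathrm{ite}(y,0,1),y)$, and a multiplexer with select $s$ as the single call $\mathrm{ite}(s,t,e)$. The adder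 inputs are $c_{-1},a_0,b_0,\dots,a_{n-1},b_{n-1}$, also in this variable order (from the root downwards); $c_i=a_ib_i+a_ic_{i-1}+b_ic_{i-1}$ and $s_i=a_i\oplus b_i\oplus c_{i-1}$ for $0\le i<n$. The *Conditional Sum Adder* (CoSA) of bit-width $1$ is a full adder made of AND-, OR- and EXOR-gates. The CoSA of bit-width $n\ge2$ consists of a CoSA for the lower $\lfloor n/2\rfloor$ bits, which receives the carry input, of two CoSAs for the upper $\lceil n/2\rceil$ bits, with carry inputs $0$ and $1$, and of a multiplexer stage that selects the upper sum bits and the carry output from the results of these two, controlled by the carry output of the lower CoSA. **Theorem 3.** There are a polynomial $p$ and a constant $C$ such that for every $n\ge1$ the symbolic simulation of the $n$-bit CoSA, including all of its recursively nested sub-adders, runs in time at most $p(n)$ and space at most $p(n)$ (a recursion stack with $2n+2$ places is enough), and yields for every signal of the circuit the reduced ordered BDD of the Boolean function computed by that signal. Each of these BDDs, in particular that of each signal that connects sub-adders and multiplexers, has size at most $C\cdot n$. The BDDs obtained for the $n$ sum outputs and the carry output represent $s_0,\dots,s_{n-1}$ and $c_{n-1}$. -/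

import Mathlib

namespace PolyAdd

/-! ## Shared reduced ordered BDDs, and the `ite` algorithm with a step count -/

/-- A decision node: the tested variable, the low-successor and the high-successor.
Variables are numbered by their position in the variable order (smaller = closer to the root). -/
structure Node where
  var : ℕ
  lo : ℕ
  hi : ℕ
deriving DecidableEq

/-- The memory of a BDD package. References to BDDs are numbers: `0` and `1` are the terminals,
`k + 2` is the node in position `k` of the unique table. `computed` is the computed table of `ite`;
`steps` counts the elementary steps made so far. -/
structure State where
  nodes : List Node
  computed : List ((ℕ × ℕ × ℕ) × ℕ)
  steps : ℕ

/-- The empty BDD package. -/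
def State.empty : State := ⟨[], [], 0⟩

/-- Charge `t` elementary steps. -/
def State.tick (σ : State) (t : ℕ) : State := { σ with steps := σ.steps + t }

/-- The node a reference points to (`none` for a terminal). -/
def nodeAt (nodes : List Node) : ℕ → Option Node
  | 0 => none
  | 1 => none
  | k + 2 => nodes[k]?

/-- The terminal cases of `ite`. -/
def terminalCase (F G H : ℕ) : Option ℕ :=
  if F = 1 then some G
  else if F = 0 then some H
  else if G = H then some G
  else if G = 1 ∧ H = 0 then some F
  else none

/-- The top variable of three BDDs (at least one of which is not a terminal). -/
def topVar (nodes : List Node) (F G H : ℕ) : ℕ :=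
  ((([F, G, H].filterMap (nodeAt nodes)).map Node.var).min?).getD 0

/-- The cofactor of a BDD to `x_v = b`, where `v` is not below its top variable. -/
def cofactor (nodes : List Node) (v : ℕ) (b : Bool) (F : ℕ) : ℕ :=
  match nodeAt nodes F with
  | none => F
  | some N => if N.var = v then (if b then N.hi else N.lo) else F

/-- Search the unique table for the node `(v, lo, hi)` and append it if it is missing. The search
is charged as a scan of the whole table (the worst case of any hashing). -/
def findOrAdd (v lo hi : ℕ) (σ : State) : ℕ × State :=
  let k := σ.nodes.idxOf ⟨v, lo, hi⟩
  let τ := σ.tick (σ.nodes.length + 1)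
  if k < σ.nodes.length then (k + 2, τ)
  else (σ.nodes.length + 2, { τ with nodes := σ.nodes ++ [⟨v, lo, hi⟩] })

/-- The recursive `ite` algorithm with unique table and computed table. The first argument is the
size of the recursion stack: the computation fails (`none`) if more than that many
activations are open at the same time. Each activation is charged one step for the terminal
test, the whole length of the computed table for a search in it, one step for
the top variable and the cofactors, the cost of `findOrAdd`, and one step for an insertion. -/
def iteOp : ℕ → ℕ → ℕ → ℕ → State → Option (ℕ × State)
  | 0, _, _, _, _ => none
  | d + 1, F, G, H, σ =>
    let σ₁ := σ.tick 1
    match terminalCase F G H with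
    | some R => some (R, σ₁)
    | none =>
      let σ₂ := σ₁.tick (σ₁.computed.length + 1)
      match σ₂.computed.lookup (F, G, H) with
      | some R => some (R, σ₂)
      | none =>
        let v := topVar σ₂.nodes F G H
        let cof := fun b X => cofactor σ₂.nodes v b X
        match iteOp d (cof true F) (cof true G) (cof true H) (σ₂.tick 1) with
        | none => none
        | some (Rh, σ₃) =>
          match iteOp d (cof false F) (cof false G) (cof false H) σ₃ with
          | none => none
          | some (Rl, σ₄) =>
            if Rh = Rl then some (Rh, σ₄)
            else
              let q := findOrAdd v Rl Rh σ₄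
              some (q.1, { q.2.tick 1 with computed := ((F, G, H), q.1) :: q.2.computed })

/-- `Evaluates nodes ρ r b`: under the assignment `ρ` the path from reference `r` ends in the
terminal `b`. -/
inductive Evaluates (nodes : List Node) (ρ : ℕ → Bool) : ℕ → Bool → Prop
  | zero : Evaluates nodes ρ 0 false
  | one : Evaluates nodes ρ 1 true
  | node (r : ℕ) (N : Node) (b : Bool) (hN : nodeAt nodes r = some N)
      (h : Evaluates nodes ρ (if ρ N.var then N.hi else N.lo) b) : Evaluates nodes ρ r b

/-- The BDD with root `r` represents the Boolean function `f`. -/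
def Represents (nodes : List Node) (r : ℕ) (f : (ℕ → Bool) → Bool) : Prop :=
  ∀ ρ, Evaluates nodes ρ r (f ρ)

/-- The stored diagrams are reduced ordered BDDs: successors are references to older nodes (so the
graph is acyclic), variables increase along edges, no node is redundant, no node is
stored twice. -/
structure IsROBDD (nodes : List Node) : Prop where
  acyclic : ∀ (k : ℕ) (N : Node), nodes[k]? = some N → N.lo < k + 2 ∧ N.hi < k + 2
  ordered : ∀ (k : ℕ) (N : Node), nodes[k]? = some N → ∀ M : Node,
    nodeAt nodes N.lo = some M ∨ nodeAt nodes N.hi = some M → N.var < M.var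
  nonredundant : ∀ N ∈ nodes, N.lo ≠ N.hi
  nodup : nodes.Nodup

/-- `Reaches nodes r q`: the vertex `q` belongs to the BDD with root `r`. -/
inductive Reaches (nodes : List Node) (r : ℕ) : ℕ → Prop
  | root : Reaches nodes r r
  | lo (q : ℕ) (N : Node) (h : Reaches nodes r q) (hN : nodeAt nodes q = some N) :
      Reaches nodes r N.lo
  | hi (q : ℕ) (N : Node) (h : Reaches nodes r q) (hN : nodeAt nodes q = some N) :
      Reaches nodes r N.hi

/-- The size of the BDD with root `r`: its number of vertices, terminals included. -/
noncomputable def bddSize (nodes : List Node) (r : ℕ) : ℕ∞ := {q | Reaches nodes r q}.encard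

/-! ## Circuits and their symbolic simulation -/

/-- Gates. Arguments of logic gates are wires; `mux s t e` outputs `t` if `s = 1` and `e`
otherwise. -/
inductive Gate where
  | const (b : Bool)
  | input (v : ℕ)
  | and (x y : ℕ)
  | or (x y : ℕ)
  | xor (x y : ℕ)
  | mux (s t e : ℕ)

/-- The value of a gate, given the values of the earlier wires. -/
def Gate.value (ρ : ℕ → Bool) (vals : List Bool) : Gate → Bool
  | .const b => b
  | .input v => ρ v
  | .and x y => vals.getD x false && vals.getD y false
  | .or x y => vals.getD x false || vals.getD y false
  | .xor x y => Bool.xor (vals.getD x false) (vals.getD y false)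
  | .mux s t e => if vals.getD s false then vals.getD t false else vals.getD e false

/-- A circuit is a list of gates in topological order; wire `k` is the output of gate number `k`.
This is the list of the values of all wires. -/
def wireValues (ρ : ℕ → Bool) (gates : List Gate) : List Bool :=
  gates.foldl (fun vals g => vals ++ [g.value ρ vals]) []

/-- The synthesis operation of a gate, given the BDDs of the earlier wires; `d` is the size of the
recursion stack. Every multiplexer is one call of `ite`. It fails if a wire does not exist. -/
def simGate (d : ℕ) (refs : List ℕ) (σ : State) : Gate → Option (ℕ × State)
  | .const b => some (b.toNat, σ)
  | .input v => some (findOrAdd v 0 1 σ)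
  | .and x y => do
      let X ← refs[x]?
      let Y ← refs[y]?
      iteOp d X Y 0 σ
  | .or x y => do
      let X ← refs[x]?
      let Y ← refs[y]?
      iteOp d X 1 Y σ
  | .xor x y => do
      let X ← refs[x]?
      let Y ← refs[y]?
      let q ← iteOp d Y 0 1 σ
      iteOp d X q.1 Y q.2
  | .mux s t e => do
      let S ← refs[s]?
      let T ← refs[t]?
      let E ← refs[e]?
      iteOp d S T E σ

/-- Symbolic simulation: process the gates in topological order, and keep the BDDs of all
wires. Each gate is charged one step in addition to its `ite` calls. -/
def simulate (d : ℕ) : List Gate → List ℕ → State → Option (List ℕ × State)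
  | [], refs, σ => some (refs, σ)
  | g :: gs, refs, σ =>
    match simGate d refs (σ.tick 1) g with
    | none => none
    | some (r, τ) => simulate d gs (refs ++ [r]) τ

/-- The memory cells in use at the end: unique table, computed table, references of the wires, and
the recursion stack of size `d`. The tables never shrink, so this is also the peak. -/
def spaceUsed (d : ℕ) (refs : List ℕ) (σ : State) : ℕ :=
  σ.nodes.length + σ.computed.length + refs.length + d

/-! ## The Conditional Sum Adder -/

/-- The carry into bit `i`, that is `c_{i-1}`. The incoming carry `c_{-1}` is the variable `0`,
and `a_i`, `b_i` are the variables `2i+1`, `2i+2`. -/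
def carry (ρ : ℕ → Bool) : ℕ → Bool
  | 0 => ρ 0
  | i + 1 => (ρ (2 * i + 1) && ρ (2 * i + 2)) || (ρ (2 * i + 1) && carry ρ i) ||
      (ρ (2 * i + 2) && carry ρ i)

/-- The sum bit `s_i`. -/
def sumBit (ρ : ℕ → Bool) (i : ℕ) : Bool :=
  Bool.xor (Bool.xor (ρ (2 * i + 1)) (ρ (2 * i + 2))) (carry ρ i)

/-- A subcircuit: its gates, its sum wires (least significant first) and its carry-out wire. -/
structure Block where
  gates : List Gate
  sum : List ℕ
  cout : ℕ

/-- A full adder whose gates are numbered from `w`, for input wires `a`, `b`, `c`. -/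
def fullAdder (w a b c : ℕ) : Block where
  gates := [.and a b, .or a b, .and c (w + 1), .or w (w + 2), .xor a b, .xor (w + 4) c]
  sum := [w + 5]
  cout := w + 3

/-- The wires of the constants, the incoming carry and the operand bits. -/
def zeroWire : ℕ := 0
def oneWire : ℕ := 1
def cinWire : ℕ := 2
def aWire (i : ℕ) : ℕ := 2 * i + 3
def bWire (i : ℕ) : ℕ := 2 * i + 4

/-- The Conditional Sum Adder of bit-width `n` for the bits `l, …, l + n - 1`, with carry input on
wire `c` and gates numbered from `w`: one CoSA for the lower half, two CoSAs for the
upper half with carry inputs `0` and `1`, and a multiplexer stage controlled by the carry output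
of the lower half. (For width `0` there is nothing to do.) -/
def cosa (n l w c : ℕ) : Block :=
  match n with
  | 0 => ⟨[], [], c⟩
  | 1 => fullAdder w (aWire l) (bWire l) c
  | k + 2 =>
    let m := (k + 2) / 2
    let low := cosa m l w c
    let w₀ := w + low.gates.length
    let up₀ := cosa (k + 2 - m) (l + m) w₀ zeroWire
    let w₁ := w₀ + up₀.gates.length
    let up₁ := cosa (k + 2 - m) (l + m) w₁ oneWire
    let w₂ := w₁ + up₁.gates.length
    { gates := low.gates ++ up₀.gates ++ up₁.gates ++
        List.zipWith (Gate.mux low.cout) (up₁.sum ++ [up₁.cout]) (up₀.sum ++ [up₀.cout])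
      sum := low.sum ++ List.range' w₂ (k + 2 - m)
      cout := w₂ + (k + 2 - m) }
termination_by n
decreasing_by all_goals omega

/-- The two constants and the inputs `c_{-1}, a_0, b_0, …, a_{n-1}, b_{n-1}`. -/
def sources (n : ℕ) : List Gate :=
  [.const false, .const true] ++ (List.range (2 * n + 1)).map .input

/-- The `n`-bit Conditional Sum Adder without its sources. -/
def cosaBlock (n : ℕ) : Block := cosa n 0 (2 * n + 3) cinWire

/-- The whole `n`-bit Conditional Sum Adder. -/
def cosaCircuit (n : ℕ) : List Gate := sources n ++ (cosaBlock n).gates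

end PolyAdd

namespace PolyAdd

/-! Two facts carry the theorem: every signal has a linear-size diagram, and every `ite` call made
by the simulation is linear in that size.

Size. In the interleaved order, fix all variables before `v` in a sum or carry output of an adder
block. What remains is determined by three bits: the carry into the current bit position, the
operand bit of that position that may already have been read, and the value of the output in case it
is already decided (`narrow_blockOut`). Distinct vertices of a reduced ordered BDD compute distinct
functions (`IsROBDD.val_injective`), and each is a restriction of the function of the root, so there
are at most eight vertices per variable (`IsROBDD.bddSize_le`). Signals inside a full adder depend
on three variables at most and are narrow for that reason.

Time. Multiplying the sizes of the operands is avoided. The select signal of a multiplexer is a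
carry out of the lower half, so it reads only variables before those of the upper half. The data
inputs come from upper adders with constant carry input, so they read only variables of the upper
half. Hence `ite(F, G, H)` walks through `F` alone, carrying `G` and `H` along unchanged, and the
computed table lets it expand each vertex of `F` at most once (`Run.exists_new_entries`). This needs
the fact that no such expansion has equal results on both branches, because such results are not
cached. Calls for gates of a full adder involve three variables and are bounded by the full binary
recursion tree (`Run.lt_two_pow`).

Total. Each activation adds at most one entry to each table and costs at most the two table lengths
plus a constant. The number of gates is at most cubic (`cosa_length`), so the number of activations,
the tables and the time are polynomial. Correctness of `ite` is Shannon expansion (`Run.spec`), and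
the stack bound holds because the top variable increases along the recursion (`exists_run`). -/

/-! ### References and the structure of the store. -/

theorem nodeAt_eq_some {nodes : List Node} {r : ℕ} {N : Node} :
    nodeAt nodes r = some N ↔ ∃ k, r = k + 2 ∧ nodes[k]? = some N := by
  rcases r with _ | _ | k <;> simp [nodeAt]

/-- `r` is a terminal or refers to a stored node. -/
def Valid (nodes : List Node) (r : ℕ) : Prop := r < nodes.length + 2

theorem Valid.zero (nodes : List Node) : Valid nodes 0 := by simp [Valid]

theorem Valid.one (nodes : List Node) : Valid nodes 1 := by simp [Valid]

theorem Valid.mono {nodes nodes' : List Node} {r : ℕ} (h : Valid nodes r)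
    (hp : nodes <+: nodes') : Valid nodes' r := by
  have := hp.length_le
  unfold Valid at *
  omega

theorem Valid.of_nodeAt {nodes : List Node} {r : ℕ} {N : Node}
    (h : nodeAt nodes r = some N) : Valid nodes r := by
  obtain ⟨k, rfl, hk⟩ := nodeAt_eq_some.1 h
  have := (List.getElem?_eq_some_iff.1 hk).1
  unfold Valid
  omega

theorem Valid.exists_nodeAt {nodes : List Node} {r : ℕ} (h : Valid nodes r) (h0 : r ≠ 0)
    (h1 : r ≠ 1) : ∃ N, nodeAt nodes r = some N := by
  obtain ⟨k, rfl⟩ : ∃ k, r = k + 2 := ⟨r - 2, by omega⟩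
  have hk : k < nodes.length := by unfold Valid at h; omega
  exact ⟨nodes[k], by simp [nodeAt, hk]⟩

theorem nodeAt_mono {nodes nodes' : List Node} {r : ℕ} {N : Node}
    (hp : nodes <+: nodes') (h : nodeAt nodes r = some N) : nodeAt nodes' r = some N := by
  obtain ⟨k, rfl, hk⟩ := nodeAt_eq_some.1 h
  obtain ⟨l, rfl⟩ := hp
  have := (List.getElem?_eq_some_iff.1 hk).1
  simpa [nodeAt, List.getElem?_append_left this] using hk

theorem nodeAt_of_valid {nodes nodes' : List Node} {r : ℕ} (hp : nodes <+: nodes')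
    (h : Valid nodes r) : nodeAt nodes' r = nodeAt nodes r := by
  by_cases h0 : r = 0
  · simp [h0, nodeAt]
  by_cases h1 : r = 1
  · simp [h1, nodeAt]
  obtain ⟨N, hN⟩ := h.exists_nodeAt h0 h1
  rw [hN, nodeAt_mono hp hN]

theorem nodeAt_mem {nodes : List Node} {r : ℕ} {N : Node} (h : nodeAt nodes r = some N) :
    N ∈ nodes := by
  obtain ⟨k, rfl, hk⟩ := nodeAt_eq_some.1 h
  exact List.mem_of_getElem? hk

namespace IsROBDD

variable {nodes : List Node}

theorem child_lt (hR : IsROBDD nodes) {r : ℕ} {N : Node} (h : nodeAt nodes r = some N)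
    (b : Bool) : (if b then N.hi else N.lo) < r := by
  obtain ⟨k, rfl, hk⟩ := nodeAt_eq_some.1 h
  have := hR.acyclic k N hk
  cases b <;> simp [this]

theorem child_valid (hR : IsROBDD nodes) {r : ℕ} {N : Node} (h : nodeAt nodes r = some N)
    (b : Bool) : Valid nodes (if b then N.hi else N.lo) :=
  (hR.child_lt h b).trans (Valid.of_nodeAt h)

theorem var_lt_child (hR : IsROBDD nodes) {r : ℕ} {N M : Node} (h : nodeAt nodes r = some N)
    (b : Bool) (hM : nodeAt nodes (if b then N.hi else N.lo) = some M) : N.var < M.var := by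
  obtain ⟨k, rfl, hk⟩ := nodeAt_eq_some.1 h
  refine hR.ordered k N hk M ?_
  cases b
  · exact Or.inl hM
  · exact Or.inr hM

theorem eq_of_nodeAt (hR : IsROBDD nodes) {r s : ℕ} {N : Node} (hr : nodeAt nodes r = some N)
    (hs : nodeAt nodes s = some N) : r = s := by
  obtain ⟨i, rfl, hi⟩ := nodeAt_eq_some.1 hr
  obtain ⟨j, rfl, hj⟩ := nodeAt_eq_some.1 hs
  have hlt := (List.getElem?_eq_some_iff.1 hi).1
  rw [(List.getElem?_inj hlt hR.nodup).1 (hi.trans hj.symm)]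

end IsROBDD

/-! ### Semantics of references. -/

theorem Evaluates.unique {nodes : List Node} {ρ : ℕ → Bool} {r : ℕ} {b b' : Bool}
    (h : Evaluates nodes ρ r b) (h' : Evaluates nodes ρ r b') : b = b' := by
  induction h with
  | zero =>
    cases h' with
    | zero => rfl
    | node _ N _ hN => simp [nodeAt] at hN
  | one =>
    cases h' with
    | one => rfl
    | node _ N _ hN => simp [nodeAt] at hN
  | node r N b hN _ ih =>
    cases h' with
    | zero => simp [nodeAt] at hN
    | one => simp [nodeAt] at hN
    | node _ N' _ hN' h' =>
      obtain rfl : N = N' := Option.some.inj (hN.symm.trans hN')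
      exact ih h'

theorem Evaluates.mono {nodes nodes' : List Node} {ρ : ℕ → Bool} {r : ℕ} {b : Bool}
    (hp : nodes <+: nodes') (h : Evaluates nodes ρ r b) : Evaluates nodes' ρ r b := by
  induction h with
  | zero => exact .zero
  | one => exact .one
  | node r N b hN _ ih => exact .node r N b (nodeAt_mono hp hN) ih

theorem IsROBDD.exists_evaluates {nodes : List Node} (hR : IsROBDD nodes) (ρ : ℕ → Bool) {r : ℕ}
    (h : Valid nodes r) : ∃ b, Evaluates nodes ρ r b := by
  induction r using Nat.strong_induction_on with
  | _ r ih =>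
    by_cases h0 : r = 0
    · subst h0; exact ⟨_, .zero⟩
    by_cases h1 : r = 1
    · subst h1; exact ⟨_, .one⟩
    obtain ⟨N, hN⟩ := h.exists_nodeAt h0 h1
    obtain ⟨b, hb⟩ := ih _ (hR.child_lt hN (ρ N.var)) (hR.child_valid hN _)
    exact ⟨b, .node r N b hN hb⟩

open Classical in
/-- The Boolean function of the reference `r`. -/
noncomputable def val (nodes : List Node) (r : ℕ) (ρ : ℕ → Bool) : Bool :=
  decide (Evaluates nodes ρ r true)

theorem Evaluates.val_eq {nodes : List Node} {ρ : ℕ → Bool} {r : ℕ} {b : Bool}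
    (h : Evaluates nodes ρ r b) : val nodes r ρ = b := by
  cases b
  · simpa [val] using fun h' => Bool.noConfusion (h.unique h')
  · simpa [val] using h

@[simp] theorem val_zero (nodes : List Node) (ρ : ℕ → Bool) : val nodes 0 ρ = false :=
  Evaluates.zero.val_eq

@[simp] theorem val_one (nodes : List Node) (ρ : ℕ → Bool) : val nodes 1 ρ = true :=
  Evaluates.one.val_eq

/-- The assignment that is `ρ` before variable `v` and `τ` from there on. -/
def mix (v : ℕ) (ρ τ : ℕ → Bool) : ℕ → Bool := fun i => if i < v then ρ i else τ i

theorem mix_zero (ρ τ : ℕ → Bool) : mix 0 ρ τ = τ := rfl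

namespace IsROBDD

variable {nodes : List Node}

theorem evaluates (hR : IsROBDD nodes) {r : ℕ} (h : Valid nodes r) (ρ : ℕ → Bool) :
    Evaluates nodes ρ r (val nodes r ρ) := by
  obtain ⟨b, hb⟩ := hR.exists_evaluates ρ h
  rwa [hb.val_eq]

theorem represents_iff (hR : IsROBDD nodes) {r : ℕ} (h : Valid nodes r) {f : (ℕ → Bool) → Bool} :
    Represents nodes r f ↔ val nodes r = f :=
  ⟨fun hf => funext fun ρ => (hf ρ).val_eq, fun hf ρ => hf ▸ hR.evaluates h ρ⟩

theorem val_mono (hR : IsROBDD nodes) {nodes' : List Node} (hp : nodes <+: nodes') {r : ℕ}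
    (h : Valid nodes r) : val nodes' r = val nodes r :=
  funext fun ρ => ((hR.evaluates h ρ).mono hp).val_eq

theorem val_node (hR : IsROBDD nodes) {r : ℕ} {N : Node} (h : nodeAt nodes r = some N)
    (ρ : ℕ → Bool) : val nodes r ρ = val nodes (if ρ N.var then N.hi else N.lo) ρ :=
  (Evaluates.node r N _ h (hR.evaluates (hR.child_valid h _) ρ)).val_eq

end IsROBDD

/-! ### Variable order, dependence and canonicity. -/

/-- The root of `r` tests no variable before `v`. -/
def Below (nodes : List Node) (v r : ℕ) : Prop := ∀ N, nodeAt nodes r = some N → v ≤ N.var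

namespace IsROBDD

variable {nodes : List Node}

theorem below_child (hR : IsROBDD nodes) {r : ℕ} {N : Node} (h : nodeAt nodes r = some N)
    (b : Bool) : Below nodes (N.var + 1) (if b then N.hi else N.lo) :=
  fun _ hM => hR.var_lt_child h b hM

theorem dependsOn_of_below (hR : IsROBDD nodes) {r v : ℕ} (hr : Valid nodes r)
    (h : Below nodes v r) : DependsOn (val nodes r) (Set.Ici v) := by
  induction r using Nat.strong_induction_on with
  | _ r ih =>
    by_cases h0 : r = 0
    · intro ρ τ _; simp [h0]
    by_cases h1 : r = 1
    · intro ρ τ _; simp [h1]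
    obtain ⟨N, hN⟩ := hr.exists_nodeAt h0 h1
    intro ρ τ hρ
    rw [hR.val_node hN, hR.val_node hN, ← hρ _ (h N hN)]
    refine ih _ (hR.child_lt hN _) (hR.child_valid hN _) ?_ hρ
    intro M hM
    have := hR.var_lt_child hN _ hM
    have := h N hN
    omega

theorem val_update (hR : IsROBDD nodes) {r v : ℕ} (hr : Valid nodes r)
    (h : Below nodes (v + 1) r) (ρ : ℕ → Bool) (b : Bool) :
    val nodes r (Function.update ρ v b) = val nodes r ρ := by
  refine hR.dependsOn_of_below hr h fun i hi => ?_
  have : v + 1 ≤ i := hi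
  rw [Function.update_of_ne (by omega)]

theorem val_child (hR : IsROBDD nodes) {r : ℕ} {N : Node} (h : nodeAt nodes r = some N)
    (b : Bool) (ρ : ℕ → Bool) :
    val nodes (if b then N.hi else N.lo) ρ = val nodes r (Function.update ρ N.var b) := by
  rw [hR.val_node h, Function.update_self, hR.val_update (hR.child_valid h b) (hR.below_child h b)]

/-- Reduced ordered BDDs are canonical. -/
theorem val_injective (hR : IsROBDD nodes) {r s : ℕ} (hr : Valid nodes r) (hs : Valid nodes s)
    (h : val nodes r = val nodes s) : r = s := by
  -- The induction is on a common bound for both references, because it is also applied to the two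
  -- children of one node.
  suffices H : ∀ n r s : ℕ, r < n → s < n → Valid nodes r → Valid nodes s →
      val nodes r = val nodes s → r = s from
    H (max r s + 1) r s (by omega) (by omega) hr hs h
  clear h hr hs r s
  intro n
  induction n with
  | zero => intro r s hr; omega
  | succ n ih =>
    -- By symmetry the reference whose root variable comes first may be taken as `r`.
    have key : ∀ r s : ℕ, r < n + 1 → s < n + 1 → Valid nodes r → Valid nodes s →
        val nodes r = val nodes s → ∀ N, nodeAt nodes r = some N → Below nodes N.var s →
        r = s := by
      intro r s hrn hsn hr hs h N hN hb
      have hlo := hR.child_lt hN false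
      have hhi := hR.child_lt hN true
      by_cases hsv : ∃ N', nodeAt nodes s = some N' ∧ N'.var = N.var
      · obtain ⟨N', hN', hv⟩ := hsv
        have hlo' := hR.child_lt hN' false
        have hhi' := hR.child_lt hN' true
        have hc : ∀ b : Bool, (if b then N.hi else N.lo) = if b then N'.hi else N'.lo := by
          intro b
          have h1 := hR.child_lt hN b
          have h2 := hR.child_lt hN' b
          refine ih _ _ (by omega) (by omega) (hR.child_valid hN b) (hR.child_valid hN' b) ?_
          funext ρ
          rw [hR.val_child hN, hR.val_child hN', h, hv]
        have e : N = N' := by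
          have h1 := hc true
          have h2 := hc false
          cases N; cases N'; simp_all
        exact hR.eq_of_nodeAt hN (e ▸ hN')
      -- Here `s` ignores the variable tested by `r`, so both children of `r` compute the function
      -- of `s`; by induction they coincide, and the node would be redundant.
      · exfalso
        have hb' : Below nodes (N.var + 1) s := by
          intro M hM
          have h1 := hb M hM
          have h2 : M.var ≠ N.var := fun h2 => hsv ⟨M, hM, h2⟩
          omega
        refine hR.nonredundant N (nodeAt_mem hN) ?_
        refine ih _ _ (by simp at hlo; omega) (by simp at hhi; omega)
          (hR.child_valid hN false) (hR.child_valid hN true) ?_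
        funext ρ
        have h1 := hR.val_child hN false ρ
        have h2 := hR.val_child hN true ρ
        rw [h, hR.val_update hs hb'] at h1 h2
        exact h1.trans h2.symm
    intro r s hrn hsn hr hs h
    rcases hNr : nodeAt nodes r with _ | N
    · rcases hNs : nodeAt nodes s with _ | N'
      · have tr : ∀ q, Valid nodes q → nodeAt nodes q = none → q = 0 ∨ q = 1 := by
          intro q hq hn
          by_contra hc
          push Not at hc
          obtain ⟨N, hN⟩ := hq.exists_nodeAt hc.1 hc.2
          simp [hN] at hn
        have h' := congrFun h fun _ => true
        rcases tr r hr hNr with rfl | rfl <;> rcases tr s hs hNs with rfl | rfl <;> simp_all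
      · exact (key s r hsn hrn hs hr h.symm N' hNs fun M hM => by simp [hNr] at hM).symm
    · rcases hNs : nodeAt nodes s with _ | N'
      · exact key r s hrn hsn hr hs h N hNr fun M hM => by simp [hNs] at hM
      · rcases le_total N.var N'.var with hle | hle
        · refine key r s hrn hsn hr hs h N hNr fun M hM => ?_
          obtain rfl := Option.some.inj (hNs.symm.trans hM); exact hle
        · refine (key s r hsn hrn hs hr h.symm N' hNs fun M hM => ?_).symm
          obtain rfl := Option.some.inj (hNr.symm.trans hM); exact hle

/-- A node depends on the variable it tests. -/
theorem exists_update_ne (hR : IsROBDD nodes) {r : ℕ} {N : Node} (h : nodeAt nodes r = some N) :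
    ∃ ρ, val nodes r (Function.update ρ N.var false) ≠
      val nodes r (Function.update ρ N.var true) := by
  by_contra hc
  push Not at hc
  refine hR.nonredundant N (nodeAt_mem h) ?_
  refine hR.val_injective (hR.child_valid h false) (hR.child_valid h true) (funext fun ρ => ?_)
  exact (hR.val_child h false ρ).trans ((hc ρ).trans (hR.val_child h true ρ).symm)

/-- This turns a semantic statement into a structural one: in a reduced diagram a root variable is
always essential, so a bound on the dependence of the function locates the root in the order. -/
theorem var_mem_of_dependsOn (hR : IsROBDD nodes) {r : ℕ} {N : Node} {S : Set ℕ}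
    (h : nodeAt nodes r = some N) (hS : DependsOn (val nodes r) S) : N.var ∈ S := by
  by_contra hv
  obtain ⟨ρ, hρ⟩ := hR.exists_update_ne h
  refine hρ (hS fun i hi => ?_)
  have : i ≠ N.var := fun e => hv (e ▸ hi)
  rw [Function.update_of_ne this, Function.update_of_ne this]

theorem below_of_dependsOn (hR : IsROBDD nodes) {r v : ℕ}
    (h : DependsOn (val nodes r) (Set.Ici v)) : Below nodes v r :=
  fun _ hN => hR.var_mem_of_dependsOn hN h

/-- The fixed part of a restriction may be extended up to the root of `q`, since `q` reads none of
the variables in between. This normalizes the level before vertices are compared. -/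
theorem val_eq_mix (hR : IsROBDD nodes) {r q v w : ℕ} (hq : Valid nodes q)
    (hv : Below nodes v q) (hw : w ≤ v) {ρ : ℕ → Bool}
    (h : ∀ τ, val nodes q τ = val nodes r (mix w ρ τ)) (τ : ℕ → Bool) :
    val nodes q τ = val nodes r (mix v ρ τ) := by
  have h1 : val nodes q τ = val nodes q (mix v ρ τ) := by
    refine hR.dependsOn_of_below hq hv fun i hi => ?_
    have : v ≤ i := hi
    simp [mix, this]
  rw [h1, h]
  congr 1
  funext i
  by_cases h1 : i < w
  · simp [mix, h1, h1.trans_le hw]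
  · simp [mix, h1]

/-- The function of a vertex of a BDD is a restriction of the function of the root. -/
theorem exists_val_eq_mix (hR : IsROBDD nodes) {r q : ℕ} (hr : Valid nodes r)
    (h : Reaches nodes r q) : Valid nodes q ∧
      ∃ w ρ, Below nodes w q ∧ ∀ τ, val nodes q τ = val nodes r (mix w ρ τ) := by
  have step : ∀ (q : ℕ) (N : Node) (b : Bool), nodeAt nodes q = some N → (Valid nodes q ∧
      ∃ w ρ, Below nodes w q ∧ ∀ τ, val nodes q τ = val nodes r (mix w ρ τ)) →
      (Valid nodes (if b then N.hi else N.lo) ∧ ∃ w ρ, Below nodes w (if b then N.hi else N.lo) ∧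
        ∀ τ, val nodes (if b then N.hi else N.lo) τ = val nodes r (mix w ρ τ)) := by
    rintro q N b hN ⟨hq, w, ρ, hw, h⟩
    refine ⟨hR.child_valid hN b, N.var + 1, Function.update ρ N.var b, hR.below_child hN b,
      fun τ => ?_⟩
    have hb : Below nodes N.var q := fun M hM => by
      obtain rfl := Option.some.inj (hN.symm.trans hM); exact le_rfl
    rw [hR.val_child hN, hR.val_eq_mix hq hb (hw N hN) h]
    congr 1
    funext i
    rcases lt_trichotomy i N.var with hi | hi | hi
    · simp [mix, hi, hi.ne, hi.trans (Nat.lt_succ_self _)]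
    · simp [mix, hi]
    · simp [mix, hi.ne', hi.not_gt, Nat.not_lt.2 (Nat.succ_le_of_lt hi)]
  induction h with
  | root => exact ⟨hr, 0, fun _ => false, fun _ _ => Nat.zero_le _, fun τ => by rw [mix_zero]⟩
  | lo q N _ hN ih => exact step q N false hN ih
  | hi q N _ hN ih => exact step q N true hN ih

end IsROBDD

/-! ### Narrow functions have linear-size diagrams. -/

/-- Before each variable, the restrictions of `f` fall into at most eight classes. -/
def Narrow (f : (ℕ → Bool) → Bool) : Prop :=
  ∀ v, ∃ key : (ℕ → Bool) → Bool × Bool × Bool, ∀ ρ ρ', key ρ = key ρ' →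
    ∀ τ, f (mix v ρ τ) = f (mix v ρ' τ)

/-- A decision vertex is identified by its variable and the key of a path leading to it: equal pairs
give equal restrictions of the root function, hence equal references by canonicity. This yields
eight vertices for each of `M` variables, plus two terminals. -/
theorem IsROBDD.bddSize_le {nodes : List Node} (hR : IsROBDD nodes) {M : ℕ}
    (hM : ∀ N ∈ nodes, N.var < M) {r : ℕ} (hr : Valid nodes r) (hf : Narrow (val nodes r)) :
    bddSize nodes r ≤ ((8 * M + 2 : ℕ) : ℕ∞) := by
  choose key hkey using hf
  let A : Set ℕ := {q | Reaches nodes r q ∧ ∃ N, nodeAt nodes q = some N}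
  have hA : ∀ q : ℕ, ∃ t : ℕ × Bool × Bool × Bool, q ∈ A → ∃ N ρ, nodeAt nodes q = some N ∧
      t = (N.var, key N.var ρ) ∧ ∀ τ, val nodes q τ = val nodes r (mix N.var ρ τ) := by
    intro q
    by_cases hq : q ∈ A
    · obtain ⟨hq, N, hN⟩ := hq
      obtain ⟨hv, w, ρ, hw, h⟩ := hR.exists_val_eq_mix hr hq
      refine ⟨(N.var, key N.var ρ), fun _ => ⟨N, ρ, hN, rfl, ?_⟩⟩
      refine hR.val_eq_mix hv (fun M hM => ?_) (hw N hN) h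
      obtain rfl := Option.some.inj (hN.symm.trans hM); exact le_rfl
    · exact ⟨default, fun h => absurd h hq⟩
  choose φ hφ using hA
  have hmaps : Set.MapsTo φ A (↑(Finset.range M ×ˢ (Finset.univ : Finset (Bool × Bool × Bool)))) := by
    intro q hq
    obtain ⟨N, ρ, hN, h, -⟩ := hφ q hq
    simpa [h] using hM N (nodeAt_mem hN)
  have hinj : Set.InjOn φ A := by
    intro q hq q' hq' h
    obtain ⟨N, ρ, hN, h1, h2⟩ := hφ q hq
    obtain ⟨N', ρ', hN', h1', h2'⟩ := hφ q' hq'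
    rw [h1, h1', Prod.mk.injEq] at h
    refine hR.val_injective (.of_nodeAt hN) (.of_nodeAt hN') (funext fun τ => ?_)
    rw [h2, h2', ← h.1]
    exact hkey _ _ _ (by rw [h.2, h.1]) τ
  have hsub : {q | Reaches nodes r q} ⊆ A ∪ {0, 1} := by
    intro q hq
    by_cases h0 : q = 0
    · simp [h0]
    by_cases h1 : q = 1
    · simp [h1]
    exact Or.inl ⟨hq, (hR.exists_val_eq_mix hr hq).1.exists_nodeAt h0 h1⟩
  calc bddSize nodes r ≤ (A ∪ {0, 1}).encard := Set.encard_le_encard hsub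
    _ ≤ A.encard + ({0, 1} : Set ℕ).encard := Set.encard_union_le _ _
    _ ≤ ((8 * M : ℕ) : ℕ∞) + 2 := by
      refine add_le_add ?_ (Set.encard_pair (by norm_num)).le
      refine (Set.encard_le_encard_of_injOn hmaps hinj).trans ?_
      rw [Set.encard_coe_eq_coe_finsetCard]
      simp [mul_comm]
    _ = _ := by push_cast; rfl

/-! ### The invariant of the memory. -/

/-- Invariant of the memory: the nodes form reduced ordered BDDs over the variables below `M`, and
the computed table is correct. -/
structure Good (M : ℕ) (σ : State) : Prop where
  robdd : IsROBDD σ.nodes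
  vars : ∀ N ∈ σ.nodes, N.var < M
  computed : ∀ F G H R : ℕ, ((F, G, H), R) ∈ σ.computed →
    Valid σ.nodes F ∧ Valid σ.nodes G ∧ Valid σ.nodes H ∧ Valid σ.nodes R ∧
    ∀ ρ, val σ.nodes R ρ = if val σ.nodes F ρ then val σ.nodes G ρ else val σ.nodes H ρ

theorem Good.empty (M : ℕ) : Good M State.empty where
  robdd := by constructor <;> simp [State.empty]
  vars := by simp [State.empty]
  computed := by simp [State.empty]

theorem Good.tick {M : ℕ} {σ : State} (h : Good M σ) (t : ℕ) : Good M (σ.tick t) :=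
  ⟨h.robdd, h.vars, h.computed⟩

theorem findOrAdd_of_mem {v lo hi : ℕ} {σ : State} (h : (⟨v, lo, hi⟩ : Node) ∈ σ.nodes) :
    findOrAdd v lo hi σ =
      (σ.nodes.idxOf ⟨v, lo, hi⟩ + 2, σ.tick (σ.nodes.length + 1)) := by
  simp [findOrAdd, List.idxOf_lt_length_iff.2 h]

theorem findOrAdd_of_notMem {v lo hi : ℕ} {σ : State} (h : (⟨v, lo, hi⟩ : Node) ∉ σ.nodes) :
    findOrAdd v lo hi σ = (σ.nodes.length + 2,
      { σ.tick (σ.nodes.length + 1) with nodes := σ.nodes ++ [⟨v, lo, hi⟩] }) := by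
  have : ¬ σ.nodes.idxOf ⟨v, lo, hi⟩ < σ.nodes.length := fun h' => h (List.idxOf_lt_length_iff.1 h')
  simp [findOrAdd, this]

theorem findOrAdd_computed (v lo hi : ℕ) (σ : State) :
    (findOrAdd v lo hi σ).2.computed = σ.computed := by
  by_cases h : (⟨v, lo, hi⟩ : Node) ∈ σ.nodes
  · rw [findOrAdd_of_mem h]; rfl
  · rw [findOrAdd_of_notMem h]; rfl

theorem findOrAdd_steps (v lo hi : ℕ) (σ : State) :
    (findOrAdd v lo hi σ).2.steps = σ.steps + (σ.nodes.length + 1) := by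
  by_cases h : (⟨v, lo, hi⟩ : Node) ∈ σ.nodes
  · rw [findOrAdd_of_mem h]; rfl
  · rw [findOrAdd_of_notMem h]; rfl

theorem findOrAdd_prefix (v lo hi : ℕ) (σ : State) :
    σ.nodes <+: (findOrAdd v lo hi σ).2.nodes := by
  by_cases h : (⟨v, lo, hi⟩ : Node) ∈ σ.nodes
  · rw [findOrAdd_of_mem h]; exact List.prefix_rfl
  · rw [findOrAdd_of_notMem h]; exact List.prefix_append _ _

theorem findOrAdd_length_le (v lo hi : ℕ) (σ : State) :
    (findOrAdd v lo hi σ).2.nodes.length ≤ σ.nodes.length + 1 := by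
  by_cases h : (⟨v, lo, hi⟩ : Node) ∈ σ.nodes
  · rw [findOrAdd_of_mem h]; exact Nat.le_succ _
  · rw [findOrAdd_of_notMem h]; simp

theorem findOrAdd_nodeAt (v lo hi : ℕ) (σ : State) :
    nodeAt (findOrAdd v lo hi σ).2.nodes (findOrAdd v lo hi σ).1 = some ⟨v, lo, hi⟩ := by
  by_cases h : (⟨v, lo, hi⟩ : Node) ∈ σ.nodes
  · rw [findOrAdd_of_mem h]
    exact List.getElem?_idxOf h
  · rw [findOrAdd_of_notMem h]
    simp [nodeAt]

theorem Good.computed_mono {M : ℕ} {σ : State} (h : Good M σ) {nodes : List Node}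
    (hp : σ.nodes <+: nodes) (F G H R : ℕ) (hm : ((F, G, H), R) ∈ σ.computed) :
    Valid nodes F ∧ Valid nodes G ∧ Valid nodes H ∧ Valid nodes R ∧
    ∀ ρ, val nodes R ρ = if val nodes F ρ then val nodes G ρ else val nodes H ρ := by
  obtain ⟨hF, hG, hH, hR, e⟩ := h.computed F G H R hm
  refine ⟨hF.mono hp, hG.mono hp, hH.mono hp, hR.mono hp, ?_⟩
  rw [h.robdd.val_mono hp hF, h.robdd.val_mono hp hG, h.robdd.val_mono hp hH,
    h.robdd.val_mono hp hR]
  exact e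

theorem Good.findOrAdd {M v lo hi : ℕ} {σ : State} (h : Good M σ) (hv : v < M)
    (hlo : Valid σ.nodes lo) (hhi : Valid σ.nodes hi) (blo : Below σ.nodes (v + 1) lo)
    (bhi : Below σ.nodes (v + 1) hi) (hne : lo ≠ hi) : Good M (findOrAdd v lo hi σ).2 := by
  by_cases hm : (⟨v, lo, hi⟩ : Node) ∈ σ.nodes
  · rw [findOrAdd_of_mem hm]; exact h.tick _
  rw [findOrAdd_of_notMem hm]
  have hp : σ.nodes <+: σ.nodes ++ [⟨v, lo, hi⟩] := List.prefix_append _ _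
  -- A node of the extended table is either old, and its successors keep their meaning, or it is the
  -- appended one.
  have split : ∀ (k : ℕ) (N : Node), (σ.nodes ++ [⟨v, lo, hi⟩])[k]? = some N →
      σ.nodes[k]? = some N ∨ (k = σ.nodes.length ∧ N = ⟨v, lo, hi⟩) := by
    intro k N hk
    rcases lt_trichotomy k σ.nodes.length with hlt | rfl | hlt
    · rw [List.getElem?_append_left hlt] at hk
      exact Or.inl hk
    · simp at hk
      exact Or.inr ⟨rfl, hk.symm⟩
    · rw [List.getElem?_eq_none (by simp; omega)] at hk
      simp at hk
  refine ⟨⟨?_, ?_, ?_, ?_⟩, ?_, ?_⟩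
  · intro k N hk
    rcases split k N hk with hk | ⟨rfl, rfl⟩
    · exact h.robdd.acyclic k N hk
    · exact ⟨hlo, hhi⟩
  · intro k N hk L hL
    rcases split k N hk with hk | ⟨rfl, rfl⟩
    · have hN : nodeAt σ.nodes (k + 2) = some N := hk
      have h1 := h.robdd.child_valid hN false
      have h2 := h.robdd.child_valid hN true
      simp only [Bool.false_eq_true, if_false, if_true] at h1 h2
      dsimp only at hL
      rw [nodeAt_of_valid hp h1, nodeAt_of_valid hp h2] at hL
      exact h.robdd.ordered k N hk L hL
    · dsimp only at hL
      rw [nodeAt_of_valid hp hlo, nodeAt_of_valid hp hhi] at hL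
      exact hL.elim (blo L) (bhi L)
  · intro N hN
    rcases List.mem_append.1 hN with hN | hN
    · exact h.robdd.nonredundant N hN
    · rw [List.mem_singleton.1 hN]; exact hne
  · refine List.Nodup.append h.robdd.nodup (List.nodup_singleton _) ?_
    simpa using hm
  · intro N hN
    rcases List.mem_append.1 hN with hN | hN
    · exact h.vars N hN
    · rw [List.mem_singleton.1 hN]; exact hv
  · exact h.computed_mono hp

theorem Good.cache {M F G H R : ℕ} {σ : State} (h : Good M σ) (hF : Valid σ.nodes F)
    (hG : Valid σ.nodes G) (hH : Valid σ.nodes H) (hR : Valid σ.nodes R)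
    (e : ∀ ρ, val σ.nodes R ρ = if val σ.nodes F ρ then val σ.nodes G ρ else val σ.nodes H ρ) :
    Good M { σ.tick 1 with computed := ((F, G, H), R) :: σ.computed } := by
  refine ⟨h.robdd, h.vars, fun F' G' H' R' hm => ?_⟩
  rcases List.mem_cons.1 hm with hm | hm
  · simp only [Prod.mk.injEq] at hm
    obtain ⟨⟨rfl, rfl, rfl⟩, rfl⟩ := hm
    exact ⟨hF, hG, hH, hR, e⟩
  · exact h.computed F' G' H' R' hm

/-! ### Terminal cases, top variable and cofactors. -/

theorem terminalCase_eq_none {F G H : ℕ} :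
    terminalCase F G H = none ↔ F ≠ 1 ∧ F ≠ 0 ∧ G ≠ H ∧ ¬ (G = 1 ∧ H = 0) := by
  unfold terminalCase
  split_ifs <;> simp_all

theorem terminalCase_sound {nodes : List Node} {F G H R : ℕ} (hF : Valid nodes F)
    (hG : Valid nodes G) (hH : Valid nodes H) (h : terminalCase F G H = some R) :
    Valid nodes R ∧
      ∀ ρ, val nodes R ρ = if val nodes F ρ then val nodes G ρ else val nodes H ρ := by
  unfold terminalCase at h
  split_ifs at h with h1 h2 h3 h4 <;> obtain rfl := Option.some.inj h
  · subst h1; exact ⟨hG, fun ρ => by simp⟩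
  · subst h2; exact ⟨hH, fun ρ => by simp⟩
  · subst h3; exact ⟨hG, fun ρ => by simp⟩
  · obtain ⟨rfl, rfl⟩ := h4; exact ⟨hF, fun ρ => by simp⟩

/-- As `F` is not a terminal, the list of root variables is nonempty, so the default value in
`topVar` plays no role. -/
theorem topVar_spec {nodes : List Node} {F G H : ℕ} {N : Node} (hN : nodeAt nodes F = some N) :
    (Below nodes (topVar nodes F G H) F ∧ Below nodes (topVar nodes F G H) G ∧
      Below nodes (topVar nodes F G H) H) ∧
    ∃ X, (X = F ∨ X = G ∨ X = H) ∧ ∃ N, nodeAt nodes X = some N ∧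
      N.var = topVar nodes F G H := by
  set L := ([F, G, H].filterMap (nodeAt nodes)).map Node.var with hL
  have hmem : ∀ x, x ∈ L ↔ ∃ X, (X = F ∨ X = G ∨ X = H) ∧ ∃ N, nodeAt nodes X = some N ∧
      N.var = x := by
    intro x
    simp only [hL, List.mem_map, List.mem_filterMap, List.mem_cons, List.not_mem_nil, or_false]
    grind
  have hne : L ≠ [] := List.ne_nil_of_mem ((hmem N.var).2 ⟨F, Or.inl rfl, N, hN, rfl⟩)
  obtain ⟨m, hm⟩ : ∃ m, L.min? = some m := by
    rcases h : L.min? with _ | m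
    · exact absurd (List.min?_eq_none_iff.1 h) hne
    · exact ⟨m, rfl⟩
  have htop : topVar nodes F G H = m := by
    unfold topVar
    rw [← hL, hm]; rfl
  obtain ⟨h1, h2⟩ := List.min?_eq_some_iff.1 hm
  rw [htop]
  refine ⟨⟨fun N hN => ?_, fun N hN => ?_, fun N hN => ?_⟩, (hmem m).1 h1⟩ <;>
  exact h2 _ ((hmem _).2 ⟨_, by tauto, N, hN, rfl⟩)

theorem cofactor_of_var_eq {nodes : List Node} {v F : ℕ} {N : Node} (h : nodeAt nodes F = some N)
    (hv : N.var = v) (b : Bool) : cofactor nodes v b F = if b then N.hi else N.lo := by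
  simp [cofactor, h, hv]

theorem cofactor_of_below {nodes : List Node} {v F : ℕ} (h : Below nodes (v + 1) F) (b : Bool) :
    cofactor nodes v b F = F := by
  unfold cofactor
  rcases hN : nodeAt nodes F with _ | N
  · rfl
  · have := h N hN
    simp [show N.var ≠ v by omega]

theorem IsROBDD.cofactor_spec {nodes : List Node} (hR : IsROBDD nodes) {v F : ℕ}
    (hF : Valid nodes F) (hv : Below nodes v F) (b : Bool) :
    Valid nodes (cofactor nodes v b F) ∧ Below nodes (v + 1) (cofactor nodes v b F) ∧
    ∀ ρ, val nodes (cofactor nodes v b F) ρ = val nodes F (Function.update ρ v b) := by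
  by_cases h : ∃ N, nodeAt nodes F = some N ∧ N.var = v
  · obtain ⟨N, hN, rfl⟩ := h
    rw [cofactor_of_var_eq hN rfl]
    exact ⟨hR.child_valid hN b, hR.below_child hN b, hR.val_child hN b⟩
  · have hb : Below nodes (v + 1) F := fun N hN =>
      Nat.lt_of_le_of_ne (hv N hN) fun e => h ⟨N, hN, e.symm⟩
    rw [cofactor_of_below hb]
    exact ⟨hF, hb, fun ρ => (hR.val_update hF hb ρ b).symm⟩

/-! ### Correctness and stack depth of `ite`. -/

/-- The state in which `ite` makes its first recursive call. -/
def State.enter (σ : State) : State := ((σ.tick 1).tick (σ.computed.length + 1)).tick 1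

/-- The state after `ite` has found or added its node and cached the result. -/
def State.store (σ : State) (v lo hi F G H : ℕ) : State :=
  { (findOrAdd v lo hi σ).2.tick 1 with
    computed := ((F, G, H), (findOrAdd v lo hi σ).1) :: (findOrAdd v lo hi σ).2.computed }

/-- `Run F G H σ R τ N`: the call of `ite` on `F, G, H` in the state `σ` returns `R` in the
state `τ` after `N` activations. -/
inductive Run : ℕ → ℕ → ℕ → State → ℕ → State → ℕ → Prop
  | terminal {F G H R : ℕ} {σ : State} (h : terminalCase F G H = some R) :
      Run F G H σ R (σ.tick 1) 1
  | hit {F G H R : ℕ} {σ : State} (ht : terminalCase F G H = none)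
      (hl : σ.computed.lookup (F, G, H) = some R) :
      Run F G H σ R ((σ.tick 1).tick (σ.computed.length + 1)) 1
  | reduce {F G H v R N₁ N₂ : ℕ} {σ τ υ : State} (ht : terminalCase F G H = none)
      (hl : σ.computed.lookup (F, G, H) = none) (hv : v = topVar σ.nodes F G H)
      (hh : Run (cofactor σ.nodes v true F) (cofactor σ.nodes v true G)
        (cofactor σ.nodes v true H) σ.enter R τ N₁)
      (hlo : Run (cofactor σ.nodes v false F) (cofactor σ.nodes v false G)
        (cofactor σ.nodes v false H) τ R υ N₂) :
      Run F G H σ R υ (N₁ + N₂ + 1)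
  | node {F G H v Rh Rl N₁ N₂ : ℕ} {σ τ υ : State} (ht : terminalCase F G H = none)
      (hl : σ.computed.lookup (F, G, H) = none) (hv : v = topVar σ.nodes F G H)
      (hh : Run (cofactor σ.nodes v true F) (cofactor σ.nodes v true G)
        (cofactor σ.nodes v true H) σ.enter Rh τ N₁)
      (hlo : Run (cofactor σ.nodes v false F) (cofactor σ.nodes v false G)
        (cofactor σ.nodes v false H) τ Rl υ N₂) (hne : Rh ≠ Rl) :
      Run F G H σ (findOrAdd v Rl Rh υ).1 (υ.store v Rl Rh F G H) (N₁ + N₂ + 1)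

theorem Good.enter {M : ℕ} {σ : State} (h : Good M σ) : Good M σ.enter :=
  ⟨h.robdd, h.vars, h.computed⟩

/-- What a correct call of `ite` achieves. -/
structure IteSpec (M F G H : ℕ) (σ : State) (R : ℕ) (τ : State) : Prop where
  good : Good M τ
  mono : σ.nodes <+: τ.nodes
  valid : Valid τ.nodes R
  val_eq : ∀ ρ, val τ.nodes R ρ =
    if val σ.nodes F ρ then val σ.nodes G ρ else val σ.nodes H ρ

/-- The situation in which `ite` expands a call: facts about its top variable and cofactors. -/
theorem Good.expand {M F G H : ℕ} {σ : State} (h : Good M σ) (hF : Valid σ.nodes F)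
    (hG : Valid σ.nodes G) (hH : Valid σ.nodes H) (ht : terminalCase F G H = none) :
    topVar σ.nodes F G H < M ∧
    (∃ X, (X = F ∨ X = G ∨ X = H) ∧ ∃ N, nodeAt σ.nodes X = some N ∧
      N.var = topVar σ.nodes F G H) ∧
    ∀ X, (X = F ∨ X = G ∨ X = H) → Below σ.nodes (topVar σ.nodes F G H) X ∧ ∀ b,
      Valid σ.nodes (cofactor σ.nodes (topVar σ.nodes F G H) b X) ∧
      Below σ.nodes (topVar σ.nodes F G H + 1) (cofactor σ.nodes (topVar σ.nodes F G H) b X) ∧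
      ∀ ρ, val σ.nodes (cofactor σ.nodes (topVar σ.nodes F G H) b X) ρ =
        val σ.nodes X (Function.update ρ (topVar σ.nodes F G H) b) := by
  obtain ⟨h1, h0, -⟩ := terminalCase_eq_none.1 ht
  obtain ⟨N, hN⟩ := hF.exists_nodeAt h0 h1
  obtain ⟨⟨bF, bG, bH⟩, hX⟩ := topVar_spec (G := G) (H := H) hN
  refine ⟨?_, hX, ?_⟩
  · obtain ⟨X, -, N, hN, e⟩ := hX
    exact e ▸ h.vars N (nodeAt_mem hN)
  · rintro X (rfl | rfl | rfl)
    · exact ⟨bF, h.robdd.cofactor_spec hF bF⟩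
    · exact ⟨bG, h.robdd.cofactor_spec hG bG⟩
    · exact ⟨bH, h.robdd.cofactor_spec hH bH⟩

/-- The two recursive calls of `ite`, related to the cofactors of the result. -/
theorem IteSpec.cofactors {M F G H v Rh Rl : ℕ} {σ τ υ : State} (h : Good M σ)
    (hF : Valid σ.nodes F) (hG : Valid σ.nodes G) (hH : Valid σ.nodes H)
    (ht : terminalCase F G H = none) (hv : v = topVar σ.nodes F G H)
    (hh : IteSpec M (cofactor σ.nodes v true F) (cofactor σ.nodes v true G)
      (cofactor σ.nodes v true H) σ.enter Rh τ)
    (hl : IteSpec M (cofactor σ.nodes v false F) (cofactor σ.nodes v false G)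
      (cofactor σ.nodes v false H) τ Rl υ) :
    σ.nodes <+: υ.nodes ∧ Valid υ.nodes Rh ∧ Valid υ.nodes Rl ∧
    Below υ.nodes (v + 1) Rh ∧ Below υ.nodes (v + 1) Rl ∧
    (∀ ρ, val υ.nodes Rh ρ = if val σ.nodes F (Function.update ρ v true) then
      val σ.nodes G (Function.update ρ v true) else val σ.nodes H (Function.update ρ v true)) ∧
    (∀ ρ, val υ.nodes Rl ρ = if val σ.nodes F (Function.update ρ v false) then
      val σ.nodes G (Function.update ρ v false) else
      val σ.nodes H (Function.update ρ v false)) := by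
  obtain ⟨-, -, hX⟩ := h.expand hF hG hH ht
  rw [← hv] at hX
  obtain ⟨bF, cF⟩ := hX F (.inl rfl)
  obtain ⟨bG, cG⟩ := hX G (.inr (.inl rfl))
  obtain ⟨bH, cH⟩ := hX H (.inr (.inr rfl))
  have hm : σ.nodes <+: τ.nodes := hh.mono
  -- The cofactors read only variables after `v`, hence so does the result. By canonicity its root
  -- then lies after `v`, which is what the order of a new node with variable `v` requires.
  have hdep : ∀ (R : ℕ) (b : Bool), (∀ ρ, val υ.nodes R ρ =
      if val σ.nodes (cofactor σ.nodes v b F) ρ then val σ.nodes (cofactor σ.nodes v b G) ρ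
      else val σ.nodes (cofactor σ.nodes v b H) ρ) → Below υ.nodes (v + 1) R := by
    intro R b e
    refine hl.good.robdd.below_of_dependsOn fun ρ τ hρ => ?_
    rw [e, e, h.robdd.dependsOn_of_below (cF b).1 (cF b).2.1 hρ,
      h.robdd.dependsOn_of_below (cG b).1 (cG b).2.1 hρ,
      h.robdd.dependsOn_of_below (cH b).1 (cH b).2.1 hρ]
  have eh : ∀ ρ, val υ.nodes Rh ρ =
      if val σ.nodes (cofactor σ.nodes v true F) ρ then
        val σ.nodes (cofactor σ.nodes v true G) ρ
      else val σ.nodes (cofactor σ.nodes v true H) ρ := by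
    rw [hh.good.robdd.val_mono hl.mono hh.valid]
    exact hh.val_eq
  have el : ∀ ρ, val υ.nodes Rl ρ =
      if val σ.nodes (cofactor σ.nodes v false F) ρ then
        val σ.nodes (cofactor σ.nodes v false G) ρ
      else val σ.nodes (cofactor σ.nodes v false H) ρ := by
    intro ρ
    rw [hl.val_eq, h.robdd.val_mono hm (cF _).1, h.robdd.val_mono hm (cG _).1,
      h.robdd.val_mono hm (cH _).1]
  refine ⟨hm.trans hl.mono, hh.valid.mono hl.mono, hl.valid, hdep _ _ eh, hdep _ _ el, ?_, ?_⟩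
  · intro ρ
    rw [eh, (cF _).2.2, (cG _).2.2, (cH _).2.2]
  · intro ρ
    rw [el, (cF _).2.2, (cG _).2.2, (cH _).2.2]

/-- Shannon expansion: at `ρ` the result agrees with the branch selected by `ρ v`, and updating `ρ`
at `v` by its own value changes nothing. -/
theorem Run.spec {M F G H R N : ℕ} {σ τ : State} (hr : Run F G H σ R τ N) (h : Good M σ)
    (hF : Valid σ.nodes F) (hG : Valid σ.nodes G) (hH : Valid σ.nodes H) :
    IteSpec M F G H σ R τ := by
  induction hr with
  | terminal ht =>
    obtain ⟨h1, h2⟩ := terminalCase_sound hF hG hH ht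
    exact ⟨h.tick 1, List.prefix_rfl, h1, h2⟩
  | hit ht hl =>
    obtain ⟨l₁, l₂, e, -⟩ := List.lookup_eq_some_iff.1 hl
    obtain ⟨-, -, -, h1, h2⟩ := h.computed _ _ _ _ (by rw [e]; exact List.mem_append_right _ List.mem_cons_self)
    exact ⟨(h.tick _).tick _, List.prefix_rfl, h1, h2⟩
  | @reduce F G H v R N₁ N₂ σ τ υ ht hl hv _ _ ih₁ ih₂ =>
    obtain ⟨-, -, hX⟩ := h.expand hF hG hH ht
    rw [← hv] at hX
    have cF := (hX F (.inl rfl)).2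
    have cG := (hX G (.inr (.inl rfl))).2
    have cH := (hX H (.inr (.inr rfl))).2
    have s₁ := ih₁ h.enter (cF _).1 (cG _).1 (cH _).1
    have hm : σ.nodes <+: τ.nodes := s₁.mono
    have s₂ := ih₂ s₁.good ((cF _).1.mono hm) ((cG _).1.mono hm) ((cH _).1.mono hm)
    obtain ⟨hp, -, hR, -, -, e₁, e₂⟩ := IteSpec.cofactors h hF hG hH ht hv s₁ s₂
    refine ⟨s₂.good, hp, hR, fun ρ => ?_⟩
    rcases hb : ρ v with _ | _
    · rw [e₂, ← hb, Function.update_eq_self]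
    · rw [e₁, ← hb, Function.update_eq_self]
  | @node F G H v Rh Rl N₁ N₂ σ τ υ ht hl hv _ _ hne ih₁ ih₂ =>
    obtain ⟨hvM, -, hX⟩ := h.expand hF hG hH ht
    rw [← hv] at hX hvM
    have cF := (hX F (.inl rfl)).2
    have cG := (hX G (.inr (.inl rfl))).2
    have cH := (hX H (.inr (.inr rfl))).2
    have s₁ := ih₁ h.enter (cF _).1 (cG _).1 (cH _).1
    have hm : σ.nodes <+: τ.nodes := s₁.mono
    have s₂ := ih₂ s₁.good ((cF _).1.mono hm) ((cG _).1.mono hm) ((cH _).1.mono hm)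
    obtain ⟨hp, hRh, hRl, bh, bl, e₁, e₂⟩ := IteSpec.cofactors h hF hG hH ht hv s₁ s₂
    have hp' := findOrAdd_prefix v Rl Rh υ
    have hg := s₂.good.findOrAdd hvM hRl hRh bl bh hne.symm
    have hn := findOrAdd_nodeAt v Rl Rh υ
    have e : ∀ ρ, val (findOrAdd v Rl Rh υ).2.nodes (findOrAdd v Rl Rh υ).1 ρ =
        if val σ.nodes F ρ then val σ.nodes G ρ else val σ.nodes H ρ := by
      intro ρ
      rw [hg.robdd.val_node hn]
      rcases hb : ρ v with _ | _
      · simp only [Bool.false_eq_true, if_false]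
        rw [s₂.good.robdd.val_mono hp' hRl, e₂, ← hb, Function.update_eq_self]
      · simp only [if_true]
        rw [s₂.good.robdd.val_mono hp' hRh, e₁, ← hb, Function.update_eq_self]
    have hpp := hp.trans hp'
    refine ⟨hg.cache (hF.mono hpp) (hG.mono hpp) (hH.mono hpp) (.of_nodeAt hn) ?_, hpp,
      .of_nodeAt hn, e⟩
    rw [h.robdd.val_mono hpp hF, h.robdd.val_mono hpp hG, h.robdd.val_mono hpp hH]
    exact e

/-- With one place more on the stack than there are variables from `v` on, `ite` succeeds. -/
theorem exists_run {M : ℕ} : ∀ {d v F G H : ℕ} {σ : State}, Good M σ → Valid σ.nodes F →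
    Valid σ.nodes G → Valid σ.nodes H → Below σ.nodes v F → Below σ.nodes v G →
    Below σ.nodes v H → v ≤ M → M < d + v →
    ∃ R τ N, iteOp d F G H σ = some (R, τ) ∧ Run F G H σ R τ N := by
  intro d
  induction d with
  | zero => intro v F G H σ _ _ _ _ _ _ _ h1 h2; omega
  | succ d ih =>
    intro v F G H σ h hF hG hH bF bG bH hvM hd
    rcases ht : terminalCase F G H with _ | R
    swap
    · exact ⟨R, _, 1, by simp [iteOp, ht], .terminal ht⟩
    rcases hl : σ.computed.lookup (F, G, H) with _ | R
    swap
    · exact ⟨R, _, 1, by simp [iteOp, ht, State.tick, hl], .hit ht hl⟩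
    obtain ⟨hvM', ⟨X, hX, N, hN, hNv⟩, hX'⟩ := h.expand hF hG hH ht
    -- The recursive calls lie below `w + 1` with `v ≤ w`, so each level of recursion uses up at
    -- least one variable. The spare place serves the last call, in which no variable is left.
    have hle : v ≤ topVar σ.nodes F G H := by
      rw [← hNv]
      rcases hX with rfl | rfl | rfl
      exacts [bF N hN, bG N hN, bH N hN]
    obtain ⟨w, hw⟩ : ∃ w, w = topVar σ.nodes F G H := ⟨_, rfl⟩
    rw [← hw] at hX' hle hvM'
    have cF := (hX' F (.inl rfl)).2
    have cG := (hX' G (.inr (.inl rfl))).2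
    have cH := (hX' H (.inr (.inr rfl))).2
    obtain ⟨Rh, τ, N₁, e₁, r₁⟩ := ih (v := w + 1) h.enter (cF true).1 (cG true).1 (cH true).1
      (cF true).2.1 (cG true).2.1 (cH true).2.1 (by omega) (by omega)
    have s₁ := r₁.spec h.enter (cF true).1 (cG true).1 (cH true).1
    have hm : σ.nodes <+: τ.nodes := s₁.mono
    have hb : ∀ {X}, Valid σ.nodes X → Below σ.nodes (w + 1) X → Below τ.nodes (w + 1) X :=
      fun hV hb N hN => hb N (by rwa [nodeAt_of_valid hm hV] at hN)
    obtain ⟨Rl, υ, N₂, e₂, r₂⟩ := ih (v := w + 1) s₁.good ((cF false).1.mono hm)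
      ((cG false).1.mono hm) ((cH false).1.mono hm) (hb (cF false).1 (cF false).2.1)
      (hb (cG false).1 (cG false).2.1) (hb (cH false).1 (cH false).2.1) (by omega) (by omega)
    have key : iteOp (d + 1) F G H σ = if Rh = Rl then some (Rh, υ) else
        some ((findOrAdd w Rl Rh υ).1, υ.store w Rl Rh F G H) := by
      subst hw
      simp only [iteOp, ht]
      rw [show (σ.tick 1).computed = σ.computed from rfl]
      rw [show ((σ.tick 1).tick (σ.computed.length + 1)).computed = σ.computed from rfl, hl]
      rw [show ((σ.tick 1).tick (σ.computed.length + 1)).nodes = σ.nodes from rfl]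
      change (match iteOp d _ _ _ σ.enter with | none => none | some (Rh, σ₃) => _) = _
      rw [e₁]
      simp only [e₂]
      rfl
    by_cases hRR : Rh = Rl
    · subst hRR
      exact ⟨Rh, υ, _, by rw [key, if_pos rfl], .reduce ht hl hw r₁ r₂⟩
    · exact ⟨_, _, _, by rw [key, if_neg hRR], .node ht hl hw r₁ r₂ hRR⟩

/-! ### Counting activations. -/

/-- The state `τ` arises from `σ` at the cost of `N` activations of `ite`. -/
structure Cost (σ τ : State) (N : ℕ) : Prop where
  nodes_mono : σ.nodes.length ≤ τ.nodes.length
  computed_mono : σ.computed.length ≤ τ.computed.length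
  nodes_le : τ.nodes.length ≤ σ.nodes.length + N
  computed_le : τ.computed.length ≤ σ.computed.length + N
  steps_le : τ.steps ≤ σ.steps + N * (τ.computed.length + τ.nodes.length + 5)

theorem Cost.trans {σ τ υ : State} {N N' : ℕ} (h : Cost σ τ N) (h' : Cost τ υ N') :
    Cost σ υ (N + N') := by
  obtain ⟨a, b, c, d, e⟩ := h
  obtain ⟨a', b', c', d', e'⟩ := h'
  refine ⟨by omega, by omega, by omega, by omega, ?_⟩
  have : N * (τ.computed.length + τ.nodes.length + 5) ≤
      N * (υ.computed.length + υ.nodes.length + 5) := Nat.mul_le_mul_left _ (by omega)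
  rw [add_mul]
  omega

theorem Cost.mono {σ τ : State} {N N' : ℕ} (h : Cost σ τ N) (hN : N ≤ N') : Cost σ τ N' := by
  obtain ⟨a, b, c, d, e⟩ := h
  exact ⟨a, b, by omega, by omega, e.trans (by gcongr)⟩

/-- An expanding activation pays the table lengths `c` and `u` as `1 + (c + 1) + 1 + (u + 1) + 1 = c
+ u + 5`. Since tables only grow, the final lengths bound every summand. -/
theorem Run.cost {F G H R N : ℕ} {σ τ : State} (hr : Run F G H σ R τ N) : Cost σ τ N := by
  -- The common part of both expanding cases: entering costs the length of the computed table plus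
  -- three.
  have hup : ∀ {σ τ υ : State} {N₁ N₂ : ℕ}, Cost σ.enter τ N₁ → Cost τ υ N₂ →
      υ.steps ≤ σ.steps + (N₁ + N₂) * (υ.computed.length + υ.nodes.length + 5)
        + σ.computed.length + 3 ∧ σ.nodes.length ≤ υ.nodes.length ∧
      σ.computed.length ≤ υ.computed.length ∧ υ.nodes.length ≤ σ.nodes.length + (N₁ + N₂) ∧
      υ.computed.length ≤ σ.computed.length + (N₁ + N₂) := by
    intro σ τ υ N₁ N₂ h h'
    obtain ⟨a, b, c, d, e⟩ := h.trans h'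
    refine ⟨e.trans ?_, a, b, c, d⟩
    simp only [State.enter, State.tick]
    omega
  induction hr with
  | terminal => constructor <;> simp [State.tick]
  | hit => constructor <;> simp [State.tick]; omega
  | reduce _ _ _ _ _ ih₁ ih₂ =>
    obtain ⟨e, a, b, c, d⟩ := hup ih₁ ih₂
    refine ⟨a, b, by omega, by omega, ?_⟩
    rw [add_mul]
    omega
  | @node F G H v Rh Rl N₁ N₂ σ τ υ _ _ _ _ _ _ ih₁ ih₂ =>
    obtain ⟨e, a, b, c, d⟩ := hup ih₁ ih₂
    have h1 := findOrAdd_length_le v Rl Rh υ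
    have h2 := (findOrAdd_prefix v Rl Rh υ).length_le
    have h3 := findOrAdd_steps v Rl Rh υ
    have h4 := findOrAdd_computed v Rl Rh υ
    have hn : (υ.store v Rl Rh F G H).nodes = (findOrAdd v Rl Rh υ).2.nodes := rfl
    have hc : (υ.store v Rl Rh F G H).computed.length = υ.computed.length + 1 := by
      simp [State.store, h4]
    have hs : (υ.store v Rl Rh F G H).steps = υ.steps + (υ.nodes.length + 1) + 1 := by
      simp [State.store, State.tick, h3]
    refine ⟨by rw [hn]; omega, by omega, by rw [hn]; omega, by omega, ?_⟩
    rw [hs, hc, hn]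
    have : (N₁ + N₂) * (υ.computed.length + υ.nodes.length + 5) ≤
      (N₁ + N₂) * (υ.computed.length + 1 + (findOrAdd v Rl Rh υ).2.nodes.length + 5) :=
      Nat.mul_le_mul_left _ (by omega)
    rw [add_mul _ 1]
    omega

theorem dependsOn_update {f g : (ℕ → Bool) → Bool} {S : Finset ℕ} {v : ℕ} {b : Bool}
    (hf : DependsOn f S) (h : ∀ ρ, g ρ = f (Function.update ρ v b)) :
    DependsOn g (S.erase v : Finset ℕ) := by
  intro ρ τ hρ
  rw [h, h]
  refine hf fun i hi => ?_
  by_cases hiv : i = v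
  · subst hiv; simp
  · rw [Function.update_of_ne hiv, Function.update_of_ne hiv]
    exact hρ i (by simpa [hiv] using hi)

/-- The number of activations is exponential in the number of variables only. -/
theorem Run.lt_two_pow {M F G H R N : ℕ} {σ τ : State} (hr : Run F G H σ R τ N) (h : Good M σ)
    (hF : Valid σ.nodes F) (hG : Valid σ.nodes G) (hH : Valid σ.nodes H) {S : Finset ℕ}
    (dF : DependsOn (val σ.nodes F) S) (dG : DependsOn (val σ.nodes G) S)
    (dH : DependsOn (val σ.nodes H) S) : N < 2 ^ (S.card + 1) := by
  -- The top variable is essential for one of the arguments, hence lies in `S`, and the cofactors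
  -- depend on `S` without it. Two subtrees with fewer than `2 ^ |S|` activations each, plus the
  -- root, stay below `2 ^ (|S| + 1)`.
  have hstep : ∀ {F G H v Rh Rl N₁ N₂ : ℕ} {σ τ υ : State} {S : Finset ℕ}, Good M σ →
      Valid σ.nodes F → Valid σ.nodes G → Valid σ.nodes H → terminalCase F G H = none →
      v = topVar σ.nodes F G H → DependsOn (val σ.nodes F) S → DependsOn (val σ.nodes G) S →
      DependsOn (val σ.nodes H) S →
      Run (cofactor σ.nodes v true F) (cofactor σ.nodes v true G)
        (cofactor σ.nodes v true H) σ.enter Rh τ N₁ →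
      Run (cofactor σ.nodes v false F) (cofactor σ.nodes v false G)
        (cofactor σ.nodes v false H) τ Rl υ N₂ →
      (Good M σ.enter → Valid σ.enter.nodes (cofactor σ.nodes v true F) →
        Valid σ.enter.nodes (cofactor σ.nodes v true G) →
        Valid σ.enter.nodes (cofactor σ.nodes v true H) → ∀ {S : Finset ℕ},
        DependsOn (val σ.enter.nodes (cofactor σ.nodes v true F)) S →
        DependsOn (val σ.enter.nodes (cofactor σ.nodes v true G)) S →
        DependsOn (val σ.enter.nodes (cofactor σ.nodes v true H)) S → N₁ < 2 ^ (S.card + 1)) →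
      (Good M τ → Valid τ.nodes (cofactor σ.nodes v false F) →
        Valid τ.nodes (cofactor σ.nodes v false G) →
        Valid τ.nodes (cofactor σ.nodes v false H) → ∀ {S : Finset ℕ},
        DependsOn (val τ.nodes (cofactor σ.nodes v false F)) S →
        DependsOn (val τ.nodes (cofactor σ.nodes v false G)) S →
        DependsOn (val τ.nodes (cofactor σ.nodes v false H)) S → N₂ < 2 ^ (S.card + 1)) →
      N₁ + N₂ + 1 < 2 ^ (S.card + 1) := by
    intro F G H v Rh Rl N₁ N₂ σ τ υ S h hF hG hH ht hv dF dG dH r₁ r₂ ih₁ ih₂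
    obtain ⟨-, ⟨X, hXm, N, hN, hNv⟩, hX⟩ := h.expand hF hG hH ht
    rw [← hv] at hX hNv
    have cF := (hX F (.inl rfl)).2
    have cG := (hX G (.inr (.inl rfl))).2
    have cH := (hX H (.inr (.inr rfl))).2
    have s₁ := r₁.spec h.enter (cF _).1 (cG _).1 (cH _).1
    have hm : σ.nodes <+: τ.nodes := s₁.mono
    have hvS : v ∈ S := by
      have hd : DependsOn (val σ.nodes X) S := by rcases hXm with rfl | rfl | rfl <;> assumption
      exact hNv ▸ h.robdd.var_mem_of_dependsOn hN hd
    have hc := Finset.card_erase_add_one hvS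
    have l₁ := ih₁ h.enter (cF _).1 (cG _).1 (cH _).1 (dependsOn_update dF (cF _).2.2)
      (dependsOn_update dG (cG _).2.2) (dependsOn_update dH (cH _).2.2)
    have l₂ := ih₂ s₁.good ((cF _).1.mono hm) ((cG _).1.mono hm) ((cH _).1.mono hm)
      (S := S.erase v)
      (by rw [h.robdd.val_mono hm (cF _).1]; exact dependsOn_update dF (cF _).2.2)
      (by rw [h.robdd.val_mono hm (cG _).1]; exact dependsOn_update dG (cG _).2.2)
      (by rw [h.robdd.val_mono hm (cH _).1]; exact dependsOn_update dH (cH _).2.2)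
    rw [hc] at l₁ l₂
    rw [pow_succ]
    omega
  induction hr generalizing S with
  | terminal => exact Nat.one_lt_two_pow (by omega)
  | hit => exact Nat.one_lt_two_pow (by omega)
  | reduce ht _ hv r₁ r₂ ih₁ ih₂ =>
    exact hstep h hF hG hH ht hv dF dG dH r₁ r₂ ih₁ ih₂
  | node ht _ hv r₁ r₂ _ ih₁ ih₂ =>
    exact hstep h hF hG hH ht hv dF dG dH r₁ r₂ ih₁ ih₂

theorem Reaches.trans {nodes : List Node} {r s q : ℕ} (h : Reaches nodes r s)
    (h' : Reaches nodes s q) : Reaches nodes r q := by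
  induction h' with
  | root => exact h
  | lo q N _ hN ih => exact .lo q N ih hN
  | hi q N _ hN ih => exact .hi q N ih hN

theorem IsROBDD.le_of_reaches {nodes : List Node} (hR : IsROBDD nodes) {r q : ℕ}
    (h : Reaches nodes r q) : q ≤ r := by
  induction h with
  | root => exact le_rfl
  | lo q N _ hN ih => exact (hR.child_lt hN false).le.trans ih
  | hi q N _ hN ih => exact (hR.child_lt hN true).le.trans ih

/-- A call of `ite` whose first argument lies above the other two expands each vertex of the
first argument at most once. -/
theorem Run.exists_new_entries {M F G H R N V : ℕ} {σ τ : State} (hr : Run F G H σ R τ N)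
    (h : Good M σ) {nodes : List Node} (hR : IsROBDD nodes) (hp : nodes <+: σ.nodes)
    (hF : Valid nodes F) (hG : Valid nodes G) (hH : Valid nodes H)
    (dF : DependsOn (val nodes F) (Set.Iio V)) (bG : Below nodes V G) (bH : Below nodes V H) :
    ∃ L : List ((ℕ × ℕ × ℕ) × ℕ), τ.computed = L ++ σ.computed ∧ N ≤ 1 + 2 * L.length ∧
      (L.map fun e => e.1.1).Nodup ∧ ∀ e ∈ L, e.1.2 = (G, H) ∧ Reaches nodes F e.1.1 ∧
        σ.computed.lookup e.1 = none := by
  have hbelow : ∀ {σ : State} {X : ℕ}, nodes <+: σ.nodes → Valid nodes X → Below nodes V X →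
      Below σ.nodes V X := fun hp hX hb N hN => hb N (by rwa [nodeAt_of_valid hp hX] at hN)
  -- The root of `F` precedes `V`, and those of `G` and `H` do not, so the top variable is that of
  -- `F` and both cofactors leave `G` and `H` untouched. Validity and dependence refer to the fixed
  -- store `nodes`, which makes them stable while the tables grow.
  have hcof : ∀ {F v : ℕ} {σ : State}, Good M σ → nodes <+: σ.nodes → Valid nodes F →
      DependsOn (val nodes F) (Set.Iio V) → terminalCase F G H = none →
      v = topVar σ.nodes F G H → ∃ K, nodeAt nodes F = some K ∧ ∀ b,
        cofactor σ.nodes v b F = (if b then K.hi else K.lo) ∧ cofactor σ.nodes v b G = G ∧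
        cofactor σ.nodes v b H = H ∧
        DependsOn (val nodes (if b then K.hi else K.lo)) (Set.Iio V) := by
    intro F v σ h hp hF dF ht hv
    obtain ⟨h1, h0, -⟩ := terminalCase_eq_none.1 ht
    obtain ⟨K, hK⟩ := hF.exists_nodeAt h0 h1
    have hK' := nodeAt_mono hp hK
    have hKV : K.var < V := hR.var_mem_of_dependsOn hK dF
    obtain ⟨-, ⟨X, hX, N, hN, e⟩, hb⟩ :=
      h.expand (hF.mono hp) (hG.mono hp) (hH.mono hp) ht
    rw [← hv] at e hb
    have hle : v ≤ K.var := (hb F (.inl rfl)).1 K hK'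
    have hbG := hbelow hp hG bG
    have hbH := hbelow hp hH bH
    have hvK : K.var = v := by
      rcases hX with rfl | rfl | rfl
      · rw [← e, Option.some.inj (hK'.symm.trans hN)]
      · have := hbG N hN; omega
      · have := hbH N hN; omega
    refine ⟨K, hK, fun b => ⟨cofactor_of_var_eq hK' hvK b, cofactor_of_below
      (fun N hN => (Nat.succ_le_of_lt (hvK ▸ hKV)).trans (hbG N hN)) b, cofactor_of_below
      (fun N hN => (Nat.succ_le_of_lt (hvK ▸ hKV)).trans (hbH N hN)) b, fun ρ τ hρ => ?_⟩⟩
    rw [hR.val_child hK, hR.val_child hK]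
    refine dF fun i hi => ?_
    by_cases hiv : i = K.var
    · subst hiv; simp
    · rw [Function.update_of_ne hiv, Function.update_of_ne hiv]
      exact hρ i hi
  induction hr generalizing nodes with
  | terminal => exact ⟨[], by simp [State.tick]⟩
  | hit => exact ⟨[], by simp [State.tick]⟩
  | @reduce F G H v R N₁ N₂ σ τ υ ht hl hv r₁ r₂ ih₁ ih₂ =>
    -- Equal results on both branches are impossible: `G` and `H` differ at some `τ'`, so the result
    -- determines the value of the child of `F`; the two children of `F` would then be equal.
    exfalso
    obtain ⟨K, hK, hc⟩ := hcof h hp hF dF ht hv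
    obtain ⟨ct, cGt, cHt, dt⟩ := hc true
    obtain ⟨cf, cGf, cHf, df⟩ := hc false
    rw [ct, cGt, cHt] at r₁
    rw [cf, cGf, cHf] at r₂
    have vt := hR.child_valid hK true
    have vf := hR.child_valid hK false
    have s₁ := r₁.spec h.enter (vt.mono hp) (hG.mono hp) (hH.mono hp)
    have hp₁ := hp.trans s₁.mono
    have s₂ := r₂.spec s₁.good (vf.mono hp₁) (hG.mono hp₁) (hH.mono hp₁)
    have e : ∀ ρ, (if val nodes (if true then K.hi else K.lo) ρ then val nodes G ρ
        else val nodes H ρ) =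
        if val nodes (if false then K.hi else K.lo) ρ then val nodes G ρ
        else val nodes H ρ := by
      intro ρ
      have e₁ := s₁.val_eq ρ
      have e₂ := s₂.val_eq ρ
      rw [s₁.good.robdd.val_mono s₂.mono s₁.valid, e₁] at e₂
      rw [hR.val_mono hp₁ vf, hR.val_mono hp₁ hG, hR.val_mono hp₁ hH] at e₂
      rw [← e₂]
      rw [show σ.enter.nodes = σ.nodes from rfl]
      rw [hR.val_mono hp vt, hR.val_mono hp hG, hR.val_mono hp hH]
    have hGH : ∃ τ, val nodes G τ ≠ val nodes H τ := by
      by_contra hcon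
      push Not at hcon
      exact (terminalCase_eq_none.1 ht).2.2.1 (hR.val_injective hG hH (funext hcon))
    obtain ⟨τ', hτ⟩ := hGH
    refine hR.nonredundant K (nodeAt_mem hK) (hR.val_injective vf vt (funext fun ρ => ?_))
    -- The children of `F` read only the part `ρ` of this assignment, while `G` and `H` read only
    -- `τ'`.
    have e' := e (mix V ρ τ')
    have m₁ : ∀ {X : ℕ}, DependsOn (val nodes X) (Set.Iio V) →
        val nodes X (mix V ρ τ') = val nodes X ρ := fun hd => hd fun i hi => by
      simp [mix, show i < V from hi]
    have m₂ : ∀ {X : ℕ}, Valid nodes X → Below nodes V X →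
        val nodes X (mix V ρ τ') = val nodes X τ' := fun hX hb =>
      hR.dependsOn_of_below hX hb fun i hi => by
      simp [mix, show V ≤ i from hi]
    rw [m₁ dt, m₁ df, m₂ hG bG, m₂ hH bH] at e'
    have key : ∀ a b c d : Bool, c ≠ d → (if a then c else d) = (if b then c else d) → b = a := by
      decide
    exact key _ _ _ _ hτ e'
  | @node F G H v Rh Rl N₁ N₂ σ τ υ ht hl hv r₁ r₂ hne ih₁ ih₂ =>
    obtain ⟨K, hK, hc⟩ := hcof h hp hF dF ht hv
    obtain ⟨ct, cGt, cHt, dt⟩ := hc true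
    obtain ⟨cf, cGf, cHf, df⟩ := hc false
    rw [ct, cGt, cHt] at r₁ ih₁
    rw [cf, cGf, cHf] at r₂ ih₂
    have vt := hR.child_valid hK true
    have vf := hR.child_valid hK false
    have s₁ := r₁.spec h.enter (vt.mono hp) (hG.mono hp) (hH.mono hp)
    have hp₁ := hp.trans s₁.mono
    obtain ⟨L₁, e₁, n₁, d₁, m₁⟩ := ih₁ h.enter hR hp vt hG hH dt bG bH hbelow hcof
    obtain ⟨L₂, e₂, n₂, d₂, m₂⟩ := ih₂ s₁.good hR hp₁ vf hG hH df bG bH hbelow hcof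
    have ec : σ.enter.computed = σ.computed := rfl
    rw [ec] at e₁ m₁
    -- Vertices below a child of `F` have smaller references than `F`, so the entry for `F` is new.
    have hlt₁ : ∀ e ∈ L₁, e.1.1 < F := fun e he =>
      (hR.le_of_reaches (m₁ e he).2.1).trans_lt (hR.child_lt hK true)
    have hlt₂ : ∀ e ∈ L₂, e.1.1 < F := fun e he =>
      (hR.le_of_reaches (m₂ e he).2.1).trans_lt (hR.child_lt hK false)
    refine ⟨((F, G, H), (findOrAdd v Rl Rh υ).1) :: (L₂ ++ L₁), ?_, ?_, ?_, ?_⟩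
    · simp only [State.store, findOrAdd_computed, e₂, e₁, List.cons_append, List.append_assoc]
    · simp only [List.length_cons, List.length_append]
      omega
    · rw [List.map_cons, List.nodup_cons, List.map_append]
      refine ⟨?_, List.Nodup.append d₂ d₁ ?_⟩
      · simp only [List.mem_append, List.mem_map, not_or, not_exists, not_and]
        exact ⟨fun e he => (hlt₂ e he).ne, fun e he => (hlt₁ e he).ne⟩
      -- The second branch starts with the entries of the first one in the table, so a shared vertex
      -- would have been found there instead of being expanded again.
      · intro x hx₂ hx₁
        obtain ⟨e, he, rfl⟩ := List.mem_map.1 hx₂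
        obtain ⟨e', he', hee⟩ := List.mem_map.1 hx₁
        have hk : e.1 = e'.1 := by
          refine Prod.ext hee.symm ?_
          rw [(m₂ e he).1, (m₁ e' he').1]
        have := (m₂ e he).2.2
        rw [e₁, List.lookup_eq_none_iff] at this
        simpa [hk] using this e' (List.mem_append_left _ he')
    · intro e he
      rcases List.mem_cons.1 he with rfl | he
      · exact ⟨rfl, .root, hl⟩
      rcases List.mem_append.1 he with he | he
      · refine ⟨(m₂ e he).1, Reaches.trans (.lo F K .root hK) (m₂ e he).2.1, ?_⟩
        have := (m₂ e he).2.2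
        rw [e₁, List.lookup_eq_none_iff] at this
        rw [List.lookup_eq_none_iff]
        exact fun p hp => this p (List.mem_append_right _ hp)
      · exact ⟨(m₁ e he).1, Reaches.trans (.hi F K .root hK) (m₁ e he).2.1, (m₁ e he).2.2⟩

/-- The first arguments of the new entries are distinct vertices of `F`, so their number is at most
its size. -/
theorem Run.le_bddSize {M F G H R N V K : ℕ} {σ τ : State} (hr : Run F G H σ R τ N)
    (h : Good M σ) (hF : Valid σ.nodes F) (hG : Valid σ.nodes G) (hH : Valid σ.nodes H)
    (dF : DependsOn (val σ.nodes F) (Set.Iio V)) (dG : DependsOn (val σ.nodes G) (Set.Ici V))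
    (dH : DependsOn (val σ.nodes H) (Set.Ici V)) (hK : bddSize σ.nodes F ≤ (K : ℕ∞)) :
    N ≤ 1 + 2 * K := by
  obtain ⟨L, -, hN, hd, hm⟩ := hr.exists_new_entries h h.robdd List.prefix_rfl hF hG hH dF
    (h.robdd.below_of_dependsOn dG) (h.robdd.below_of_dependsOn dH)
  have hsub : ((L.map fun e => e.1.1).toFinset : Set ℕ) ⊆ {q | Reaches σ.nodes F q} := by
    intro x hx
    obtain ⟨e, he, rfl⟩ := List.mem_map.1 (List.mem_toFinset.1 hx)
    exact (hm e he).2.1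
  have hle := (Set.encard_le_encard hsub).trans hK
  rw [Set.encard_coe_eq_coe_finsetCard, List.toFinset_card_of_nodup hd, List.length_map] at hle
  have : L.length ≤ K := by exact_mod_cast hle
  omega

/-! ### Functions of the wires and simulation of cheap gates. -/

/-- The Boolean function of a gate, given those of the earlier wires. -/
def Gate.fn (fs : List ((ℕ → Bool) → Bool)) (g : Gate) (ρ : ℕ → Bool) : Bool :=
  g.value ρ (fs.map fun f => f ρ)

/-- The Boolean functions of all wires after the given gates. -/
def wireFns (fs : List ((ℕ → Bool) → Bool)) (gates : List Gate) : List ((ℕ → Bool) → Bool) :=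
  gates.foldl (fun fs g => fs ++ [g.fn fs]) fs

theorem wireFns_cons (fs : List ((ℕ → Bool) → Bool)) (g : Gate) (gs : List Gate) :
    wireFns fs (g :: gs) = wireFns (fs ++ [g.fn fs]) gs := rfl

theorem wireFns_append (fs : List ((ℕ → Bool) → Bool)) (gs gs' : List Gate) :
    wireFns fs (gs ++ gs') = wireFns (wireFns fs gs) gs' := List.foldl_append

theorem wireFns_length (fs : List ((ℕ → Bool) → Bool)) (gs : List Gate) :
    (wireFns fs gs).length = fs.length + gs.length := by
  induction gs generalizing fs with
  | nil => rfl
  | cons g gs ih => rw [wireFns_cons, ih]; simp; omega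

theorem wireFns_prefix (fs : List ((ℕ → Bool) → Bool)) (gs : List Gate) :
    fs <+: wireFns fs gs := by
  induction gs generalizing fs with
  | nil => exact List.prefix_rfl
  | cons g gs ih => exact (List.prefix_append _ _).trans (ih _)

theorem wireValues_eq (ρ : ℕ → Bool) (gates : List Gate) :
    wireValues ρ gates = (wireFns [] gates).map fun f => f ρ := by
  suffices H : ∀ (gs : List Gate) (fs : List ((ℕ → Bool) → Bool)),
      gs.foldl (fun vals g => vals ++ [g.value ρ vals]) (fs.map fun f => f ρ) =
        (wireFns fs gs).map fun f => f ρ from H gates []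
  intro gs
  induction gs with
  | nil => intro fs; rfl
  | cons g gs ih =>
    intro fs
    rw [wireFns_cons, ← ih, List.foldl_cons, List.map_append]
    rfl

theorem getElem?_of_prefix {α : Type*} {l l' : List α} (h : l <+: l') {k : ℕ} {a : α}
    (hk : l[k]? = some a) : l'[k]? = some a := by
  obtain ⟨t, rfl⟩ := h
  rwa [List.getElem?_append_left (List.getElem?_eq_some_iff.1 hk).1]

theorem getD_map {fs : List ((ℕ → Bool) → Bool)} {k : ℕ} {f : (ℕ → Bool) → Bool}
    (h : fs[k]? = some f) (ρ : ℕ → Bool) : (fs.map fun f => f ρ).getD k false = f ρ := by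
  simp [List.getD, h]

/-- The variables of a full adder with carry input `c_{-1}`. -/
def localVars (i : ℕ) : Finset ℕ := {0, 2 * i + 1, 2 * i + 2}

theorem localVars_card_le (i : ℕ) : (localVars i).card ≤ 3 := Finset.card_le_three

/-- Gates that are simulated at linear cost: logic gates of local functions, and
multiplexers whose select signal lies above the other two. -/
def Gate.Cheap (M : ℕ) (fs : List ((ℕ → Bool) → Bool)) : Gate → Prop
  | .const _ => True
  | .input v => v < M
  | .and x y => ∃ i f g, fs[x]? = some f ∧ fs[y]? = some g ∧
      DependsOn f (localVars i) ∧ DependsOn g (localVars i)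
  | .or x y => ∃ i f g, fs[x]? = some f ∧ fs[y]? = some g ∧
      DependsOn f (localVars i) ∧ DependsOn g (localVars i)
  | .xor x y => ∃ i f g, fs[x]? = some f ∧ fs[y]? = some g ∧
      DependsOn f (localVars i) ∧ DependsOn g (localVars i)
  | .mux s t e => ∃ V f g h, fs[s]? = some f ∧ fs[t]? = some g ∧ fs[e]? = some h ∧
      DependsOn f (Set.Iio V) ∧ DependsOn g (Set.Ici V) ∧ DependsOn h (Set.Ici V)

/-- All gates are cheap and compute narrow functions. -/
def Admissible (M : ℕ) : List ((ℕ → Bool) → Bool) → List Gate → Prop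
  | _, [] => True
  | fs, g :: gs => g.Cheap M fs ∧ Narrow (g.fn fs) ∧ Admissible M (fs ++ [g.fn fs]) gs

theorem Admissible.append {M : ℕ} {fs : List ((ℕ → Bool) → Bool)} {gs gs' : List Gate}
    (h : Admissible M fs gs) (h' : Admissible M (wireFns fs gs) gs') :
    Admissible M fs (gs ++ gs') := by
  induction gs generalizing fs with
  | nil => exact h'
  | cons g gs ih => exact ⟨h.1, h.2.1, ih h.2.2 h'⟩

/-- The references represent the given functions. -/
structure Rep (nodes : List Node) (refs : List ℕ) (fs : List ((ℕ → Bool) → Bool)) : Prop where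
  length_eq : refs.length = fs.length
  rep : ∀ (k r : ℕ) (f : (ℕ → Bool) → Bool), refs[k]? = some r → fs[k]? = some f → Valid nodes r ∧ val nodes r = f

theorem Rep.mono {nodes nodes' : List Node} {refs : List ℕ} {fs : List ((ℕ → Bool) → Bool)}
    (h : Rep nodes refs fs) (hR : IsROBDD nodes) (hp : nodes <+: nodes') : Rep nodes' refs fs :=
  ⟨h.length_eq, fun k r f hr hf => by
    obtain ⟨h1, h2⟩ := h.rep k r f hr hf
    exact ⟨h1.mono hp, by rw [hR.val_mono hp h1, h2]⟩⟩

theorem Rep.concat {nodes : List Node} {refs : List ℕ} {fs : List ((ℕ → Bool) → Bool)}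
    (h : Rep nodes refs fs) {r : ℕ} {f : (ℕ → Bool) → Bool} (hr : Valid nodes r)
    (hf : val nodes r = f) : Rep nodes (refs ++ [r]) (fs ++ [f]) := by
  refine ⟨by simp [h.length_eq], fun k r' f' hr' hf' => ?_⟩
  rcases lt_trichotomy k fs.length with hk | rfl | hk
  · rw [List.getElem?_append_left hk] at hf'
    rw [List.getElem?_append_left (by rw [h.length_eq]; exact hk)] at hr'
    exact h.rep k r' f' hr' hf'
  · rw [List.getElem?_concat_length] at hf'
    rw [← h.length_eq, List.getElem?_concat_length] at hr'
    obtain rfl := Option.some.inj hr'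
    obtain rfl := Option.some.inj hf'
    exact ⟨hr, hf⟩
  · rw [List.getElem?_eq_none (by simp; omega)] at hf'
    simp at hf'

theorem Rep.exists_ref {nodes : List Node} {refs : List ℕ} {fs : List ((ℕ → Bool) → Bool)}
    (h : Rep nodes refs fs) {k : ℕ} {f : (ℕ → Bool) → Bool} (hf : fs[k]? = some f) :
    ∃ r, refs[k]? = some r ∧ Valid nodes r ∧ val nodes r = f := by
  have hk : k < refs.length := by rw [h.length_eq]; exact (List.getElem?_eq_some_iff.1 hf).1
  exact ⟨refs[k], List.getElem?_eq_getElem hk, h.rep k _ f (List.getElem?_eq_getElem hk) hf⟩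

theorem exists_iteOp {M F G H : ℕ} {σ : State} (h : Good M σ) (hF : Valid σ.nodes F)
    (hG : Valid σ.nodes G) (hH : Valid σ.nodes H) :
    ∃ R τ N, iteOp (M + 1) F G H σ = some (R, τ) ∧ Run F G H σ R τ N ∧
      IteSpec M F G H σ R τ := by
  obtain ⟨R, τ, N, e, r⟩ := exists_run (d := M + 1) (v := 0) h hF hG hH
    (fun _ _ => Nat.zero_le _) (fun _ _ => Nat.zero_le _) (fun _ _ => Nat.zero_le _)
    (Nat.zero_le _) (by omega)
  exact ⟨R, τ, N, e, r, r.spec h hF hG hH⟩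

theorem exists_iteOp_local {M F G H i : ℕ} {σ : State} (h : Good M σ) (hF : Valid σ.nodes F)
    (hG : Valid σ.nodes G) (hH : Valid σ.nodes H)
    (dF : DependsOn (val σ.nodes F) (localVars i)) (dG : DependsOn (val σ.nodes G) (localVars i))
    (dH : DependsOn (val σ.nodes H) (localVars i)) :
    ∃ R τ, iteOp (M + 1) F G H σ = some (R, τ) ∧ IteSpec M F G H σ R τ ∧ Cost σ τ 15 := by
  obtain ⟨R, τ, N, e, r, s⟩ := exists_iteOp h hF hG hH
  refine ⟨R, τ, e, s, r.cost.mono ?_⟩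
  have h1 := r.lt_two_pow h hF hG hH dF dG dH
  -- Three variables give fewer than `2 ^ 4` activations.
  have h2 : 2 ^ ((localVars i).card + 1) ≤ 2 ^ 4 :=
    Nat.pow_le_pow_right (by norm_num) (Nat.succ_le_succ (localVars_card_le i))
  omega

theorem dependsOn_val_zero (nodes : List Node) (S : Set ℕ) : DependsOn (val nodes 0) S :=
  fun ρ τ _ => by simp

theorem dependsOn_val_one (nodes : List Node) (S : Set ℕ) : DependsOn (val nodes 1) S :=
  fun ρ τ _ => by simp

/-- The constant covers the two worst gates: an EXOR makes two local calls of at most `15`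
activations, and a multiplexer needs `1 + 2 * (8 * M + 2)` activations by the size bound for its
narrow select signal. -/
theorem simGate_spec {M : ℕ} {fs : List ((ℕ → Bool) → Bool)} {refs : List ℕ} {σ : State}
    {g : Gate} (h : Good M σ) (hrep : Rep σ.nodes refs fs) (hfs : ∀ f ∈ fs, Narrow f)
    (hg : g.Cheap M fs) :
    ∃ r τ, simGate (M + 1) refs σ g = some (r, τ) ∧ Good M τ ∧ σ.nodes <+: τ.nodes ∧
      Valid τ.nodes r ∧ val τ.nodes r = g.fn fs ∧ Cost σ τ (16 * M + 30) := by
  cases g with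
  | const b =>
    refine ⟨b.toNat, σ, rfl, h, List.prefix_rfl, ?_, ?_, ?_⟩
    · cases b
      exacts [.zero _, .one _]
    · funext ρ
      cases b
      exacts [val_zero _ _, val_one _ _]
    · constructor <;> omega
  | input v =>
    have hn := findOrAdd_nodeAt v 0 1 σ
    have hg' := h.findOrAdd hg (.zero _) (.one _) (fun N hN => by simp [nodeAt] at hN)
      (fun N hN => by simp [nodeAt] at hN) zero_ne_one
    refine ⟨(findOrAdd v 0 1 σ).1, (findOrAdd v 0 1 σ).2, rfl, hg', findOrAdd_prefix v 0 1 σ, .of_nodeAt hn, ?_, ?_⟩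
    · funext ρ
      rw [hg'.robdd.val_node hn]
      change _ = ρ v
      rcases ρ v with _ | _ <;> simp
    · have h1 := findOrAdd_length_le v 0 1 σ
      have h2 := (findOrAdd_prefix v 0 1 σ).length_le
      have h3 := findOrAdd_steps v 0 1 σ
      have h4 := findOrAdd_computed v 0 1 σ
      refine Cost.mono (N := 1) ⟨h2, by rw [h4], h1, by rw [h4]; omega, ?_⟩ (by omega)
      omega
  | and x y =>
    obtain ⟨i, f, g, hx, hy, df, dg⟩ := hg
    obtain ⟨X, hX, vX, rfl⟩ := hrep.exists_ref hx
    obtain ⟨Y, hY, vY, rfl⟩ := hrep.exists_ref hy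
    obtain ⟨R, τ, e, s, c⟩ := exists_iteOp_local h vX vY (.zero _) df dg (dependsOn_val_zero _ _)
    refine ⟨R, τ, by simp [simGate, hX, hY, e], s.good, s.mono, s.valid, ?_, c.mono (by omega)⟩
    funext ρ
    rw [s.val_eq]
    simp only [Gate.fn, Gate.value, getD_map hx, getD_map hy, val_zero]
    cases val σ.nodes X ρ <;> simp
  | or x y =>
    obtain ⟨i, f, g, hx, hy, df, dg⟩ := hg
    obtain ⟨X, hX, vX, rfl⟩ := hrep.exists_ref hx
    obtain ⟨Y, hY, vY, rfl⟩ := hrep.exists_ref hy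
    obtain ⟨R, τ, e, s, c⟩ := exists_iteOp_local h vX (.one _) vY df (dependsOn_val_one _ _) dg
    refine ⟨R, τ, by simp [simGate, hX, hY, e], s.good, s.mono, s.valid, ?_, c.mono (by omega)⟩
    funext ρ
    rw [s.val_eq]
    simp only [Gate.fn, Gate.value, getD_map hx, getD_map hy, val_one]
    cases val σ.nodes X ρ <;> simp
  | xor x y =>
    obtain ⟨i, f, g, hx, hy, df, dg⟩ := hg
    obtain ⟨X, hX, vX, rfl⟩ := hrep.exists_ref hx
    obtain ⟨Y, hY, vY, rfl⟩ := hrep.exists_ref hy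
    obtain ⟨Q, τ, e, s, c⟩ := exists_iteOp_local h vY (.zero _) (.one _) dg
      (dependsOn_val_zero _ _) (dependsOn_val_one _ _)
    have eX := h.robdd.val_mono s.mono vX
    have eY := h.robdd.val_mono s.mono vY
    have dQ : DependsOn (val τ.nodes Q) (localVars i) := fun ρ ρ' hρ => by
      rw [s.val_eq, s.val_eq, dg hρ]; simp
    obtain ⟨R, υ, e', s', c'⟩ := exists_iteOp_local s.good (vX.mono s.mono) s.valid
      (vY.mono s.mono) (eX ▸ df) dQ (eY ▸ dg)
    refine ⟨R, υ, by simp [simGate, hX, hY, e, e'], s'.good, s.mono.trans s'.mono, s'.valid, ?_,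
      (c.trans c').mono (by omega)⟩
    funext ρ
    rw [s'.val_eq, s.val_eq, eX, eY]
    simp only [Gate.fn, Gate.value, getD_map hx, getD_map hy, val_one, val_zero]
    cases val σ.nodes X ρ <;> cases val σ.nodes Y ρ <;> simp
  | mux s t e =>
    obtain ⟨V, f, g, k, hs, ht, he, df, dg, dk⟩ := hg
    have hnf := hfs f (List.mem_of_getElem? hs)
    obtain ⟨F, hF, vF, rfl⟩ := hrep.exists_ref hs
    obtain ⟨G, hG, vG, rfl⟩ := hrep.exists_ref ht
    obtain ⟨H, hH, vH, rfl⟩ := hrep.exists_ref he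
    obtain ⟨R, τ, N, e', r, sp⟩ := exists_iteOp h vF vG vH
    have hN := r.le_bddSize h vF vG vH df dg dk (h.robdd.bddSize_le h.vars vF hnf)
    refine ⟨R, τ, by simp [simGate, hF, hG, hH, e'], sp.good, sp.mono, sp.valid, ?_,
      r.cost.mono (by omega)⟩
    funext ρ
    rw [sp.val_eq]
    simp only [Gate.fn, Gate.value, getD_map hs, getD_map ht, getD_map he]

theorem simulate_spec {M : ℕ} {gs : List Gate} {fs : List ((ℕ → Bool) → Bool)} {refs : List ℕ}
    {σ : State} (h : Good M σ) (hrep : Rep σ.nodes refs fs) (hfs : ∀ f ∈ fs, Narrow f)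
    (hgs : Admissible M fs gs) :
    ∃ refs' τ, simulate (M + 1) gs refs σ = some (refs', τ) ∧ Good M τ ∧
      Rep τ.nodes refs' (wireFns fs gs) ∧ (∀ f ∈ wireFns fs gs, Narrow f) ∧
      Cost σ τ (gs.length * (16 * M + 31)) := by
  induction gs generalizing fs refs σ with
  | nil => exact ⟨refs, σ, rfl, h, hrep, hfs, by constructor <;> simp⟩
  | cons g gs ih =>
    obtain ⟨hc, hn, ha⟩ := hgs
    obtain ⟨r, τ, e, hτ, hp, hr, hv, c⟩ := simGate_spec (h.tick 1) hrep hfs hc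
    have hfs' : ∀ f ∈ fs ++ [g.fn fs], Narrow f := by
      intro f hf
      rcases List.mem_append.1 hf with hf | hf
      · exact hfs f hf
      · rw [List.mem_singleton.1 hf]; exact hn
    obtain ⟨refs', υ, e', hυ, hrep', hfs'', c'⟩ :=
      ih hτ ((hrep.mono h.robdd hp).concat hr hv) hfs' ha
    refine ⟨refs', υ, by simp [simulate, e, e'], hυ, hrep', hfs'', ?_⟩
    -- The step charged per gate counts as one more activation, which raises the constant from `30`
    -- to `31`.
    have ct : Cost σ (σ.tick 1) 1 := by constructor <;> simp [State.tick]
    refine ((ct.trans c).trans c').mono ?_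
    rw [List.length_cons, add_mul]
    omega

/-! ### Adder functions of a block and their narrowness. -/

/-- The carry into bit `l + j` if the carry into bit `l` is `c`. -/
def blockCarry (l : ℕ) (c : Bool) (ρ : ℕ → Bool) : ℕ → Bool
  | 0 => c
  | j + 1 => (ρ (2 * (l + j) + 1) && ρ (2 * (l + j) + 2)) ||
      (ρ (2 * (l + j) + 1) && blockCarry l c ρ j) || (ρ (2 * (l + j) + 2) && blockCarry l c ρ j)

/-- The sum bit `l + j` if the carry into bit `l` is `c`. -/
def blockSum (l : ℕ) (c : Bool) (ρ : ℕ → Bool) (j : ℕ) : Bool :=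
  Bool.xor (Bool.xor (ρ (2 * (l + j) + 1)) (ρ (2 * (l + j) + 2))) (blockCarry l c ρ j)

/-- The outputs of an adder for the bits `l, …, l + n - 1`: the sum bits, then the carry. -/
def blockOut (l n k : ℕ) (c : Bool) (ρ : ℕ → Bool) : Bool :=
  if k < n then blockSum l c ρ k else blockCarry l c ρ n

theorem blockCarry_zero_eq (ρ : ℕ → Bool) (j : ℕ) : blockCarry 0 (ρ 0) ρ j = carry ρ j := by
  induction j with
  | zero => rfl
  | succ j ih => simp only [blockCarry, carry, ih, zero_add]

theorem blockSum_zero_eq (ρ : ℕ → Bool) (j : ℕ) : blockSum 0 (ρ 0) ρ j = sumBit ρ j := by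
  simp only [blockSum, sumBit, blockCarry_zero_eq, zero_add]

theorem blockCarry_add (l m : ℕ) (c : Bool) (ρ : ℕ → Bool) (j : ℕ) :
    blockCarry (l + m) (blockCarry l c ρ m) ρ j = blockCarry l c ρ (m + j) := by
  induction j with
  | zero => rfl
  | succ j ih => rw [← add_assoc]; simp only [blockCarry, ih, add_assoc]

/-- The principle of conditional sums: selecting by the true carry between two precomputed results
is the same as feeding that carry into the upper half. -/
theorem blockOut_select (l m u j : ℕ) (c : Bool) (ρ : ℕ → Bool) :
    (if blockCarry l c ρ m then blockOut (l + m) u j true ρ else blockOut (l + m) u j false ρ) =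
      blockOut l (m + u) (m + j) c ρ := by
  have h : (if blockCarry l c ρ m then blockOut (l + m) u j true ρ
      else blockOut (l + m) u j false ρ) = blockOut (l + m) u j (blockCarry l c ρ m) ρ := by
    cases blockCarry l c ρ m <;> rfl
  rw [h]
  simp only [blockOut, blockSum, blockCarry_add, add_lt_add_iff_left, add_assoc]

theorem blockCarry_congr {l : ℕ} {c : Bool} {ρ τ : ℕ → Bool} {j : ℕ}
    (h : ∀ i, 2 * l + 1 ≤ i → i < 2 * (l + j) + 1 → ρ i = τ i) :
    blockCarry l c ρ j = blockCarry l c τ j := by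
  induction j with
  | zero => rfl
  | succ j ih =>
    rw [blockCarry, blockCarry, ih fun i h1 h2 => h i h1 (by omega), h (2 * (l + j) + 1) (by omega)
      (by omega), h (2 * (l + j) + 2) (by omega) (by omega)]

theorem blockSum_congr {l : ℕ} {c : Bool} {ρ τ : ℕ → Bool} {j : ℕ}
    (h : ∀ i, 2 * l + 1 ≤ i → i < 2 * (l + j) + 3 → ρ i = τ i) :
    blockSum l c ρ j = blockSum l c τ j := by
  rw [blockSum, blockSum, blockCarry_congr fun i h1 h2 => h i h1 (by omega),
    h (2 * (l + j) + 1) (by omega) (by omega), h (2 * (l + j) + 2) (by omega) (by omega)]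

theorem blockOut_dependsOn (l n k : ℕ) (c : Bool) :
    DependsOn (blockOut l n k c) (Set.Ici (2 * l + 1)) := by
  intro ρ τ h
  unfold blockOut
  rw [blockCarry_congr fun i hi _ => h i hi, blockSum_congr fun i hi _ => h i hi]

theorem blockCarry_dependsOn {cf : (ℕ → Bool) → Bool} (hcf : DependsOn cf {0}) (l m : ℕ) :
    DependsOn (fun ρ => blockCarry l (cf ρ) ρ m) (Set.Iio (2 * (l + m) + 1)) := by
  intro ρ τ h
  have : cf ρ = cf τ := hcf fun i hi => h i (by rw [Set.mem_singleton_iff.1 hi]; simp)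
  simp only [this]
  exact blockCarry_congr fun i _ hi => h i hi

/-- The key consists of the carry into the current position, the first operand bit there, and the
output value, which matters only if the output is already decided. -/
theorem narrow_blockOut {cf : (ℕ → Bool) → Bool} (hcf : DependsOn cf {0}) (l n k : ℕ) :
    Narrow fun ρ => blockOut l n k (cf ρ) ρ := by
  intro v
  -- For positive `v` the variable `0`, the only one that `cf` may read, is among the fixed ones.
  rcases Nat.eq_zero_or_pos v with rfl | hv
  · exact ⟨fun _ => default, fun ρ ρ' _ τ => by rw [mix_zero, mix_zero]⟩
  -- The number of block positions, counted from `l`, whose two variables both precede `v`.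
  -- Truncated subtraction gives `0` if the block has not been reached yet.
  obtain ⟨j₀, hj₀⟩ : ∃ j₀, j₀ = (v - 1) / 2 - l := ⟨_, rfl⟩
  refine ⟨fun ρ => (blockCarry l (cf ρ) ρ j₀, ρ (2 * (l + j₀) + 1), blockOut l n k (cf ρ) ρ),
    fun ρ ρ' hkey τ => ?_⟩
  simp only [Prod.mk.injEq] at hkey
  obtain ⟨k₁, k₂, k₃⟩ := hkey
  have hmix : ∀ {ρ : ℕ → Bool} {i : ℕ}, i < v → mix v ρ τ i = ρ i := fun h => by simp [mix, h]
  have hc : ∀ ρ, cf (mix v ρ τ) = cf ρ := fun ρ => hcf fun i hi => by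
    rw [Set.mem_singleton_iff.1 hi, hmix hv]
  -- From position `j₀` on, only the first operand bit of that position can already be fixed, and
  -- the key records it.
  have hB : ∀ i, 2 * (l + j₀) + 1 ≤ i → mix v ρ τ i = mix v ρ' τ i := by
    intro i hi
    by_cases hiv : i < v
    · obtain rfl : i = 2 * (l + j₀) + 1 := by omega
      rw [hmix hiv, hmix hiv, k₂]
    · simp [mix, hiv]
  have hlow : ∀ (ρ : ℕ → Bool) (c : Bool) (j : ℕ), j ≤ j₀ →
      blockCarry l c (mix v ρ τ) j = blockCarry l c ρ j := fun ρ c j hj =>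
    blockCarry_congr fun i h1 h2 => hmix (by omega)
  have hhigh : ∀ j, j₀ ≤ j →
      blockCarry l (cf ρ) (mix v ρ τ) j = blockCarry l (cf ρ') (mix v ρ' τ) j := by
    intro j hj
    induction j, hj using Nat.le_induction with
    | base => rw [hlow _ _ _ le_rfl, hlow _ _ _ le_rfl, k₁]
    | succ j hj ih =>
      rw [blockCarry, blockCarry, ih, hB _ (by omega), hB (2 * (l + j) + 2) (by omega)]
  simp only [hc]
  unfold blockOut at k₃ ⊢
  by_cases hk : k < n
  · simp only [hk, if_true] at k₃ ⊢
    by_cases hkj : k < j₀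
    · have hs : ∀ (ρ : ℕ → Bool) (c : Bool),
          blockSum l c (mix v ρ τ) k = blockSum l c ρ k := fun ρ c =>
        blockSum_congr fun i _ h2 => hmix (by omega)
      rw [hs, hs, k₃]
    · rw [blockSum, blockSum, hhigh k (by omega), hB _ (by omega),
        hB (2 * (l + k) + 2) (by omega)]
  · simp only [hk, if_false] at k₃ ⊢
    by_cases hnj : n < j₀
    · rw [hlow _ _ _ hnj.le, hlow _ _ _ hnj.le, k₃]
    · exact hhigh n (by omega)

theorem narrow_of_local {f : (ℕ → Bool) → Bool} {i : ℕ} (h : DependsOn f (localVars i)) :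
    Narrow f := by
  intro v
  refine ⟨fun ρ => (ρ 0, ρ (2 * i + 1), ρ (2 * i + 2)), fun ρ ρ' hkey τ => h fun j hj => ?_⟩
  simp only [Prod.mk.injEq] at hkey
  simp only [localVars, Finset.coe_insert, Finset.coe_singleton, Set.mem_insert_iff,
    Set.mem_singleton_iff] at hj
  unfold mix
  rcases hj with rfl | rfl | rfl <;> simp [hkey]

theorem narrow_var (v : ℕ) : Narrow fun ρ => ρ v := by
  intro w
  refine ⟨fun ρ => (ρ v, default), fun ρ ρ' hkey τ => ?_⟩
  simp only [Prod.mk.injEq] at hkey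
  simp [mix, hkey.1]

theorem narrow_const (b : Bool) : Narrow fun _ => b :=
  narrow_of_local (i := 0) fun _ _ _ => rfl

/-! ### The full adder and the multiplexer stage. -/

theorem dependsOn_map₂ {f g : (ℕ → Bool) → Bool} {S : Set ℕ} (op : Bool → Bool → Bool)
    (hf : DependsOn f S) (hg : DependsOn g S) : DependsOn (fun ρ => op (f ρ) (g ρ)) S :=
  fun ρ τ h => by simp only [hf h, hg h]

theorem getElem?_concat_of_length {α : Type*} {l : List α} {k : ℕ} (h : l.length = k) (a : α) :
    (l ++ [a])[k]? = some a := by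
  subst h; exact List.getElem?_concat_length

theorem getElem?_concat_of_some {α : Type*} {l : List α} {k : ℕ} {a : α} (h : l[k]? = some a)
    (b : α) : (l ++ [b])[k]? = some a := getElem?_of_prefix (List.prefix_append _ _) h

section Steps

variable {M i x y : ℕ} {fs : List ((ℕ → Bool) → Bool)} {f g : (ℕ → Bool) → Bool}
  {gs : List Gate}

theorem Gate.fn_and (hx : fs[x]? = some f) (hy : fs[y]? = some g) :
    (Gate.and x y).fn fs = fun ρ => Bool.and (f ρ) (g ρ) := by
  funext ρ; simp only [Gate.fn, Gate.value, getD_map hx, getD_map hy]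

theorem Gate.fn_or (hx : fs[x]? = some f) (hy : fs[y]? = some g) :
    (Gate.or x y).fn fs = fun ρ => Bool.or (f ρ) (g ρ) := by
  funext ρ; simp only [Gate.fn, Gate.value, getD_map hx, getD_map hy]

theorem Gate.fn_xor (hx : fs[x]? = some f) (hy : fs[y]? = some g) :
    (Gate.xor x y).fn fs = fun ρ => Bool.xor (f ρ) (g ρ) := by
  funext ρ; simp only [Gate.fn, Gate.value, getD_map hx, getD_map hy]

theorem Gate.fn_mux {s t e : ℕ} {h : (ℕ → Bool) → Bool} (hs : fs[s]? = some f)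
    (ht : fs[t]? = some g) (he : fs[e]? = some h) :
    (Gate.mux s t e).fn fs = fun ρ => if f ρ then g ρ else h ρ := by
  funext ρ; simp only [Gate.fn, Gate.value, getD_map hs, getD_map ht, getD_map he]

theorem Admissible.and (hx : fs[x]? = some f) (hy : fs[y]? = some g)
    (df : DependsOn f (localVars i)) (dg : DependsOn g (localVars i))
    (h : Admissible M (fs ++ [fun ρ => Bool.and (f ρ) (g ρ)]) gs) :
    Admissible M fs (.and x y :: gs) := by
  refine ⟨⟨i, f, g, hx, hy, df, dg⟩, ?_, ?_⟩ <;> rw [Gate.fn_and hx hy]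
  exacts [narrow_of_local (dependsOn_map₂ _ df dg), h]

theorem Admissible.or (hx : fs[x]? = some f) (hy : fs[y]? = some g)
    (df : DependsOn f (localVars i)) (dg : DependsOn g (localVars i))
    (h : Admissible M (fs ++ [fun ρ => Bool.or (f ρ) (g ρ)]) gs) :
    Admissible M fs (.or x y :: gs) := by
  refine ⟨⟨i, f, g, hx, hy, df, dg⟩, ?_, ?_⟩ <;> rw [Gate.fn_or hx hy]
  exacts [narrow_of_local (dependsOn_map₂ _ df dg), h]

theorem Admissible.xor (hx : fs[x]? = some f) (hy : fs[y]? = some g)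
    (df : DependsOn f (localVars i)) (dg : DependsOn g (localVars i))
    (h : Admissible M (fs ++ [fun ρ => Bool.xor (f ρ) (g ρ)]) gs) :
    Admissible M fs (.xor x y :: gs) := by
  refine ⟨⟨i, f, g, hx, hy, df, dg⟩, ?_, ?_⟩ <;> rw [Gate.fn_xor hx hy]
  exacts [narrow_of_local (dependsOn_map₂ _ df dg), h]

end Steps

theorem fullAdder_spec {M i w a b c : ℕ} {fs : List ((ℕ → Bool) → Bool)}
    {cf : (ℕ → Bool) → Bool} (hw : fs.length = w) (ha : fs[a]? = some fun ρ => ρ (2 * i + 1))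
    (hb : fs[b]? = some fun ρ => ρ (2 * i + 2)) (hc : fs[c]? = some cf)
    (hcf : DependsOn cf {0}) :
    Admissible M fs (fullAdder w a b c).gates ∧
    (wireFns fs (fullAdder w a b c).gates)[w + 5]? =
      some (fun ρ => blockSum i (cf ρ) ρ 0) ∧
    (wireFns fs (fullAdder w a b c).gates)[w + 3]? =
      some (fun ρ => blockCarry i (cf ρ) ρ 1) := by
  have da : DependsOn (fun ρ : ℕ → Bool => ρ (2 * i + 1)) (localVars i) :=
    fun ρ τ h => h _ (by simp [localVars])
  have db : DependsOn (fun ρ : ℕ → Bool => ρ (2 * i + 2)) (localVars i) :=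
    fun ρ τ h => h _ (by simp [localVars])
  have dc : DependsOn cf (localVars i) := fun ρ τ h => hcf fun j hj => h j (by
    rw [Set.mem_singleton_iff.1 hj]; simp [localVars])
  have dand := dependsOn_map₂ Bool.and da db
  have dor := dependsOn_map₂ Bool.or da db
  have dcor := dependsOn_map₂ Bool.and dc dor
  have dxor := dependsOn_map₂ Bool.xor da db
  -- Opaque names turn the list of wire functions into a list of atoms, so that the gate lemmas
  -- rewrite by syntactic matching.
  generalize hA : (fun ρ : ℕ → Bool => ρ (2 * i + 1)) = A at ha da
  generalize hB : (fun ρ : ℕ → Bool => ρ (2 * i + 2)) = B at hb db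
  generalize hf₀ : (fun ρ : ℕ → Bool => Bool.and (ρ (2 * i + 1)) (ρ (2 * i + 2))) = f₀ at dand
  generalize hf₁ : (fun ρ : ℕ → Bool => Bool.or (ρ (2 * i + 1)) (ρ (2 * i + 2))) = f₁ at dor
  generalize hf₂ : (fun ρ : ℕ → Bool => Bool.and (cf ρ) (Bool.or (ρ (2 * i + 1)) (ρ (2 * i + 2)))) = f₂
    at dcor
  generalize hf₄ : (fun ρ : ℕ → Bool => Bool.xor (ρ (2 * i + 1)) (ρ (2 * i + 2))) = f₄ at dxor
  have e₀ : (fun ρ => Bool.and (A ρ) (B ρ)) = f₀ := by subst hA hB hf₀; rfl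
  have e₁ : (fun ρ => Bool.or (A ρ) (B ρ)) = f₁ := by subst hA hB hf₁; rfl
  have e₂ : (fun ρ => Bool.and (cf ρ) (f₁ ρ)) = f₂ := by subst hf₁ hf₂; rfl
  have e₄ : (fun ρ => Bool.xor (A ρ) (B ρ)) = f₄ := by subst hA hB hf₄; rfl
  have e₃ : (fun ρ => Bool.or (f₀ ρ) (f₂ ρ)) = fun ρ => blockCarry i (cf ρ) ρ 1 := by
    subst hf₀ hf₂
    funext ρ
    simp only [blockCarry, add_zero]
    cases ρ (2 * i + 1) <;> cases ρ (2 * i + 2) <;> cases cf ρ <;> rfl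
  have e₅ : (fun ρ => Bool.xor (f₄ ρ) (cf ρ)) = fun ρ => blockSum i (cf ρ) ρ 0 := by
    subst hf₄
    funext ρ
    simp only [blockSum, blockCarry, add_zero]
  generalize (fun ρ => blockCarry i (cf ρ) ρ 1) = f₃ at e₃ ⊢
  generalize (fun ρ => blockSum i (cf ρ) ρ 0) = f₅ at e₅ ⊢
  have a₁ := getElem?_concat_of_some ha f₀
  have b₁ := getElem?_concat_of_some hb f₀
  have c₂ := getElem?_concat_of_some (getElem?_concat_of_some hc f₀) f₁
  have w₂ : (fs ++ [f₀] ++ [f₁])[w + 1]? = some f₁ := getElem?_concat_of_length (by simp [hw]) _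
  have u₃ : (fs ++ [f₀] ++ [f₁] ++ [f₂])[w]? = some f₀ := getElem?_concat_of_some
    (getElem?_concat_of_some (getElem?_concat_of_length hw _) _) _
  have w₃ : (fs ++ [f₀] ++ [f₁] ++ [f₂])[w + 2]? = some f₂ :=
    getElem?_concat_of_length (by simp [hw]) _
  have a₄ := getElem?_concat_of_some (getElem?_concat_of_some
    (getElem?_concat_of_some a₁ f₁) f₂) f₃
  have b₄ := getElem?_concat_of_some (getElem?_concat_of_some
    (getElem?_concat_of_some b₁ f₁) f₂) f₃
  have w₄ : (fs ++ [f₀] ++ [f₁] ++ [f₂] ++ [f₃])[w + 3]? = some f₃ :=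
    getElem?_concat_of_length (by simp [hw]) _
  have c₅ := getElem?_concat_of_some (getElem?_concat_of_some (getElem?_concat_of_some c₂ f₂) f₃) f₄
  have w₅ : (fs ++ [f₀] ++ [f₁] ++ [f₂] ++ [f₃] ++ [f₄])[w + 4]? = some f₄ :=
    getElem?_concat_of_length (by simp [hw]) _
  have w₆ : (fs ++ [f₀] ++ [f₁] ++ [f₂] ++ [f₃] ++ [f₄] ++ [f₅])[w + 5]? = some f₅ :=
    getElem?_concat_of_length (by simp [hw]) _
  have hfin : wireFns fs (fullAdder w a b c).gates =
      fs ++ [f₀] ++ [f₁] ++ [f₂] ++ [f₃] ++ [f₄] ++ [f₅] := by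
    simp only [fullAdder]
    rw [wireFns_cons, Gate.fn_and ha hb, e₀, wireFns_cons, Gate.fn_or a₁ b₁, e₁,
      wireFns_cons, Gate.fn_and c₂ w₂, e₂, wireFns_cons, Gate.fn_or u₃ w₃, e₃,
      wireFns_cons, Gate.fn_xor a₄ b₄, e₄, wireFns_cons, Gate.fn_xor w₅ c₅, e₅]
    rfl
  refine ⟨?_, by rw [hfin]; exact w₆, ?_⟩
  · refine .and ha hb da db ?_
    rw [e₀]
    refine .or a₁ b₁ da db ?_
    rw [e₁]
    refine .and c₂ w₂ dc dor ?_
    rw [e₂]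
    refine .or u₃ w₃ dand dcor ?_
    rw [e₃]
    refine .xor a₄ b₄ da db ?_
    rw [e₄]
    exact .xor w₅ c₅ dxor dc trivial
  · rw [hfin]
    exact getElem?_concat_of_some (getElem?_concat_of_some w₄ _) _

/-- All select and data wires precede the stage, so outputs appended by earlier multiplexers do not
disturb the later ones. The bound `V` separates the select signal from the data, which makes every
multiplexer cheap. -/
theorem mux_stage_spec {M s V : ℕ} {f : (ℕ → Bool) → Bool} {ts es : List ℕ}
    {fs : List ((ℕ → Bool) → Bool)} {G H : ℕ → (ℕ → Bool) → Bool} (hlen : ts.length = es.length)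
    (hs : fs[s]? = some f) (df : DependsOn f (Set.Iio V))
    (ht : ∀ k < ts.length, ∃ t, ts[k]? = some t ∧ fs[t]? = some (G k))
    (he : ∀ k < ts.length, ∃ e, es[k]? = some e ∧ fs[e]? = some (H k))
    (dG : ∀ k, DependsOn (G k) (Set.Ici V)) (dH : ∀ k, DependsOn (H k) (Set.Ici V))
    (hn : ∀ k, Narrow fun ρ => if f ρ then G k ρ else H k ρ) :
    Admissible M fs (List.zipWith (Gate.mux s) ts es) ∧ ∀ k < ts.length,
      (wireFns fs (List.zipWith (Gate.mux s) ts es))[fs.length + k]? =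
        some fun ρ => if f ρ then G k ρ else H k ρ := by
  induction ts generalizing es fs G H with
  | nil => exact ⟨trivial, fun k hk => absurd hk (Nat.not_lt_zero k)⟩
  | cons t ts ih =>
    obtain _ | ⟨e, es⟩ := es
    · simp at hlen
    obtain ⟨t', ht', hft⟩ := ht 0 (by simp)
    obtain ⟨e', he', hfe⟩ := he 0 (by simp)
    obtain rfl : t = t' := by simpa using ht'
    obtain rfl : e = e' := by simpa using he'
    have hfn := Gate.fn_mux hs hft hfe
    rw [List.zipWith_cons_cons, wireFns_cons]
    obtain ⟨h1, h2⟩ := ih (es := es) (fs := fs ++ [(Gate.mux s t e).fn fs])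
      (G := fun k => G (k + 1)) (H := fun k => H (k + 1)) (by simpa using hlen)
      (getElem?_concat_of_some hs _)
      (fun k hk => by
        obtain ⟨t', ht', h⟩ := ht (k + 1) (by simpa using hk)
        exact ⟨t', by simpa using ht', getElem?_concat_of_some h _⟩)
      (fun k hk => by
        obtain ⟨e', he', h⟩ := he (k + 1) (by simpa using hk)
        exact ⟨e', by simpa using he', getElem?_concat_of_some h _⟩)
      (fun k => dG _) (fun k => dH _) (fun k => hn _)
    refine ⟨⟨⟨V, f, G 0, H 0, hs, hft, hfe, df, dG 0, dH 0⟩, by rw [hfn]; exact hn 0, h1⟩, ?_⟩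
    intro k hk
    rcases k with _ | k
    · refine getElem?_of_prefix (wireFns_prefix _ _) ?_
      rw [hfn]
      exact getElem?_concat_of_length rfl _
    · have := h2 k (by simpa using hk)
      rw [List.length_append, List.length_singleton] at this
      rwa [show fs.length + (k + 1) = fs.length + 1 + k by omega]

/-! ### The recursive structure of the adder. -/

theorem cosa_add_two (k l w c : ℕ) {m w₀ w₁ w₂ : ℕ} {low up₀ up₁ : Block}
    (hm : m = (k + 2) / 2) (hlow : low = cosa m l w c) (hw₀ : w₀ = w + low.gates.length)
    (hup₀ : up₀ = cosa (k + 2 - m) (l + m) w₀ zeroWire) (hw₁ : w₁ = w₀ + up₀.gates.length)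
    (hup₁ : up₁ = cosa (k + 2 - m) (l + m) w₁ oneWire) (hw₂ : w₂ = w₁ + up₁.gates.length) :
    cosa (k + 2) l w c =
      { gates := low.gates ++ up₀.gates ++ up₁.gates ++
          List.zipWith (Gate.mux low.cout) (up₁.sum ++ [up₁.cout]) (up₀.sum ++ [up₀.cout])
        sum := low.sum ++ List.range' w₂ (k + 2 - m)
        cout := w₂ + (k + 2 - m) } := by
  subst hm hlow hw₀ hup₀ hw₁ hup₁ hw₂
  rw [cosa]

theorem cosa_length (n l w c : ℕ) :
    (cosa n l w c).sum.length = n ∧ (cosa n l w c).gates.length ≤ 6 * n ^ 3 := by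
  induction n using Nat.strong_induction_on generalizing l w c with
  | _ n ih =>
    match n with
    | 0 => simp [cosa]
    | 1 => simp [cosa, fullAdder]
    | k + 2 =>
      obtain ⟨m, hm⟩ : ∃ m, m = (k + 2) / 2 := ⟨_, rfl⟩
      rw [cosa_add_two k l w c hm rfl rfl rfl rfl rfl rfl]
      obtain ⟨s₁, g₁⟩ := ih m (by omega) l w c
      obtain ⟨s₂, g₂⟩ := ih (k + 2 - m) (by omega) (l + m) (w + (cosa m l w c).gates.length)
        zeroWire
      obtain ⟨s₃, g₃⟩ := ih (k + 2 - m) (by omega) (l + m) (w + (cosa m l w c).gates.length +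
        (cosa (k + 2 - m) (l + m) (w + (cosa m l w c).gates.length) zeroWire).gates.length) oneWire
      simp only [List.length_append, List.length_zipWith, List.length_singleton, s₁, s₂, s₃,
        List.length_range', min_self]
      refine ⟨by omega, ?_⟩
      obtain ⟨u, hu⟩ : ∃ u, u = k + 2 - m := ⟨_, rfl⟩
      rw [← hu] at g₂ g₃ ⊢
      have hk : k + 2 = m + u := by omega
      have hum : u ≤ m + 1 := by omega
      have hm1 : 1 ≤ m := by omega
      have hmu : m ≤ u := by omega
      -- With halves `m` and `u` the gate count is at most `6 * m ^ 3 + 2 * (6 * u ^ 3) + (u + 1)`.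
      -- Cancelling the cubes against `6 * (m + u) ^ 3` leaves this inequality; the mixed terms
      -- suffice as `u ≤ m + 1`.
      have key : 6 * u ^ 3 + (u + 1) ≤ 18 * m * u ^ 2 + 18 * m ^ 2 * u := by
        have h1 : u ^ 3 ≤ (m + 1) * u ^ 2 := by
          rw [pow_succ' u 2]; exact Nat.mul_le_mul_right _ hum
        have h2 : u ^ 2 ≤ m * u ^ 2 := Nat.le_mul_of_pos_left _ hm1
        have h3 : u ≤ m ^ 2 * u := Nat.le_mul_of_pos_left _ (by positivity)
        nlinarith
      rw [hk]
      have : (m + u) ^ 3 = m ^ 3 + 3 * m ^ 2 * u + 3 * m * u ^ 2 + u ^ 3 := by ring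
      rw [this]
      linarith

/-- The hypothesis on `cf` survives the recursion: the lower adder inherits the carry input, and the
upper ones receive constants. This is what keeps upper results independent of lower bits and hence
every multiplexer cheap. -/
theorem cosa_spec {M n l w c : ℕ} {fs : List ((ℕ → Bool) → Bool)} {cf : (ℕ → Bool) → Bool}
    (hw : fs.length = w) (h0 : fs[zeroWire]? = some fun _ => false)
    (h1 : fs[oneWire]? = some fun _ => true)
    (ha : ∀ i, l ≤ i → i < l + n → fs[aWire i]? = some fun ρ => ρ (2 * i + 1))
    (hb : ∀ i, l ≤ i → i < l + n → fs[bWire i]? = some fun ρ => ρ (2 * i + 2))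
    (hc : fs[c]? = some cf) (hcf : DependsOn cf {0}) :
    Admissible M fs (cosa n l w c).gates ∧ ∀ k ≤ n, ∃ x,
      ((cosa n l w c).sum ++ [(cosa n l w c).cout])[k]? = some x ∧
      (wireFns fs (cosa n l w c).gates)[x]? = some fun ρ => blockOut l n k (cf ρ) ρ := by
  induction n using Nat.strong_induction_on generalizing l w c cf fs with
  | _ n ih =>
    match n with
    | 0 =>
      rw [cosa]
      refine ⟨trivial, fun k hk => ⟨c, by simp [Nat.le_zero.1 hk], ?_⟩⟩
      rw [Nat.le_zero.1 hk]
      exact hc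
    | 1 =>
      rw [cosa]
      obtain ⟨g1, g2, g3⟩ := fullAdder_spec (M := M) hw (ha l le_rfl (by omega))
        (hb l le_rfl (by omega)) hc hcf
      refine ⟨g1, fun k hk => ?_⟩
      rcases k with _ | k
      · exact ⟨w + 5, rfl, g2⟩
      · obtain rfl : k = 0 := by omega
        exact ⟨w + 3, rfl, g3⟩
    | k + 2 =>
      obtain ⟨m, hm⟩ : ∃ m, m = (k + 2) / 2 := ⟨_, rfl⟩
      obtain ⟨u, hu⟩ : ∃ u, u = k + 2 - m := ⟨_, rfl⟩
      obtain ⟨low, hlow⟩ : ∃ low, low = cosa m l w c := ⟨_, rfl⟩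
      obtain ⟨up₀, hup₀⟩ : ∃ b, b = cosa (k + 2 - m) (l + m) (w + low.gates.length) zeroWire :=
        ⟨_, rfl⟩
      obtain ⟨up₁, hup₁⟩ : ∃ b, b = cosa (k + 2 - m) (l + m)
        (w + low.gates.length + up₀.gates.length) oneWire := ⟨_, rfl⟩
      rw [cosa_add_two k l w c hm hlow rfl hup₀ rfl hup₁ rfl]
      have slow := (cosa_length m l w c).1
      have sup₀ := (cosa_length u (l + m) (w + low.gates.length) zeroWire).1
      have sup₁ := (cosa_length u (l + m) (w + low.gates.length + up₀.gates.length) oneWire).1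
      rw [← hu] at hup₀ hup₁ ⊢
      have hmu : m + u = k + 2 := by omega
      obtain ⟨A₁, O₁⟩ := ih m (by omega) (l := l) hw h0 h1
        (fun i hi hi' => ha i hi (by omega)) (fun i hi hi' => hb i hi (by omega)) hc hcf
      have p₁ := wireFns_prefix fs low.gates
      rw [← hlow] at A₁ O₁ slow
      obtain ⟨A₂, O₂⟩ := ih u (by omega) (l := l + m) (fs := wireFns fs low.gates)
        (w := w + low.gates.length) (by rw [wireFns_length, hw]) (getElem?_of_prefix p₁ h0)
        (getElem?_of_prefix p₁ h1)
        (fun i hi hi' => getElem?_of_prefix p₁ (ha i (by omega) (by omega)))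
        (fun i hi hi' => getElem?_of_prefix p₁ (hb i (by omega) (by omega)))
        (getElem?_of_prefix p₁ h0) (fun _ _ _ => rfl)
      rw [← hup₀] at A₂ O₂ sup₀
      have p₂' := wireFns_prefix (wireFns fs low.gates) up₀.gates
      have p₂ := p₁.trans p₂'
      obtain ⟨A₃, O₃⟩ := ih u (by omega) (l := l + m)
        (fs := wireFns (wireFns fs low.gates) up₀.gates)
        (w := w + low.gates.length + up₀.gates.length)
        (by rw [wireFns_length, wireFns_length, hw]) (getElem?_of_prefix p₂ h0)
        (getElem?_of_prefix p₂ h1)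
        (fun i hi hi' => getElem?_of_prefix p₂ (ha i (by omega) (by omega)))
        (fun i hi hi' => getElem?_of_prefix p₂ (hb i (by omega) (by omega)))
        (getElem?_of_prefix p₂ h1) (fun _ _ _ => rfl)
      rw [← hup₁] at A₃ O₃ sup₁
      have p₃ := wireFns_prefix (wireFns (wireFns fs low.gates) up₀.gates) up₁.gates
      obtain ⟨s, hs, hfs⟩ := O₁ m le_rfl
      obtain rfl : low.cout = s := by
        rw [getElem?_concat_of_length slow] at hs
        exact Option.some.inj hs
      have hout : (fun ρ => blockOut l m m (cf ρ) ρ) = fun ρ => blockCarry l (cf ρ) ρ m := by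
        funext ρ; simp [blockOut]
      rw [hout] at hfs
      have hsel : ∀ j, (fun ρ => if blockCarry l (cf ρ) ρ m then blockOut (l + m) u j true ρ
          else blockOut (l + m) u j false ρ) = fun ρ => blockOut l (k + 2) (m + j) (cf ρ) ρ :=
        fun j => funext fun ρ => by rw [blockOut_select, hmu]
      -- The threshold is the first operand variable of the upper half.
      obtain ⟨A₄, O₄⟩ := mux_stage_spec (M := M) (s := low.cout) (V := 2 * (l + m) + 1)
        (ts := up₁.sum ++ [up₁.cout]) (es := up₀.sum ++ [up₀.cout])
        (fs := wireFns (wireFns (wireFns fs low.gates) up₀.gates) up₁.gates)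
        (G := fun j ρ => blockOut (l + m) u j true ρ)
        (H := fun j ρ => blockOut (l + m) u j false ρ)
        (by simp [sup₀, sup₁]) (getElem?_of_prefix (p₂'.trans p₃) hfs)
        (blockCarry_dependsOn hcf l m)
        (fun j hj => O₃ j (by simp [sup₁] at hj; omega))
        (fun j hj => by
          obtain ⟨x, hx, hx'⟩ := O₂ j (by simp [sup₁] at hj; omega)
          exact ⟨x, hx, getElem?_of_prefix p₃ hx'⟩)
        (fun j => blockOut_dependsOn _ _ _ _) (fun j => blockOut_dependsOn _ _ _ _)
        (fun j => by rw [hsel]; exact narrow_blockOut hcf _ _ _)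
      have p₄ := wireFns_prefix (wireFns (wireFns (wireFns fs low.gates) up₀.gates) up₁.gates)
        (List.zipWith (Gate.mux low.cout) (up₁.sum ++ [up₁.cout]) (up₀.sum ++ [up₀.cout]))
      dsimp only
      rw [wireFns_append, wireFns_append, wireFns_append]
      refine ⟨((A₁.append A₂).append (by rwa [wireFns_append])).append
        (by rwa [wireFns_append, wireFns_append]), fun j hj => ?_⟩
      -- The carry output is the wire right after the new sum wires, so sum bits and carry of the
      -- upper half form one range.
      rw [List.append_assoc, ← List.range'_1_concat]
      by_cases hjm : j < m
      · obtain ⟨x, hx, hx'⟩ := O₁ j hjm.le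
        refine ⟨x, ?_, getElem?_of_prefix ((p₂'.trans p₃).trans p₄) ?_⟩
        · rw [List.getElem?_append_left (by omega)] at hx ⊢
          exact hx
        · rw [hx']
          simp only [blockOut, hjm, if_true, show j < k + 2 by omega]
      · refine ⟨w + low.gates.length + up₀.gates.length + up₁.gates.length + (j - m), ?_, ?_⟩
        · rw [List.getElem?_append_right (by omega), slow, List.getElem?_range' (by omega)]
          simp
        · have := O₄ (j - m) (by simp [sup₁]; omega)
          rw [hsel, wireFns_length, wireFns_length, wireFns_length, hw,
            show m + (j - m) = j by omega] at this
          exact this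

/-! ### Sources and the whole circuit. -/

theorem wireFns_inputs (fs : List ((ℕ → Bool) → Bool)) (vs : List ℕ) :
    wireFns fs (vs.map Gate.input) = fs ++ vs.map fun v ρ => ρ v := by
  induction vs generalizing fs with
  | nil => simp [wireFns]
  | cons v vs ih =>
    rw [List.map_cons, wireFns_cons, ih, List.map_cons, List.append_assoc]
    rfl

theorem admissible_inputs {M : ℕ} (fs : List ((ℕ → Bool) → Bool)) (vs : List ℕ)
    (h : ∀ v ∈ vs, v < M) : Admissible M fs (vs.map Gate.input) := by
  induction vs generalizing fs with
  | nil => trivial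
  | cons v vs ih =>
    exact ⟨h v List.mem_cons_self, narrow_var v, ih _ fun x hx => h x (List.mem_cons_of_mem _ hx)⟩

theorem admissible_sources (n : ℕ) : Admissible (2 * n + 1) [] (sources n) := by
  refine ⟨trivial, narrow_const false, trivial, narrow_const true, ?_⟩
  exact admissible_inputs _ _ fun v hv => List.mem_range.1 hv

theorem wireFns_sources (n : ℕ) : wireFns [] (sources n) =
    [fun _ => false, fun _ => true] ++ (List.range (2 * n + 1)).map fun v ρ => ρ v :=
  wireFns_inputs _ _

theorem wireFns_sources_var {n v : ℕ} (h : v < 2 * n + 1) :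
    (wireFns [] (sources n))[v + 2]? = some fun ρ => ρ v := by
  rw [wireFns_sources]
  simp [h]

theorem cosaCircuit_spec (n : ℕ) :
    Admissible (2 * n + 1) [] (cosaCircuit n) ∧ ∀ k ≤ n, ∃ x,
      ((cosaBlock n).sum ++ [(cosaBlock n).cout])[k]? = some x ∧
      (wireFns [] (cosaCircuit n))[x]? = some fun ρ => blockOut 0 n k (ρ 0) ρ := by
  have h0 : (wireFns [] (sources n))[zeroWire]? = some fun _ => false := by
    rw [wireFns_sources]; rfl
  have h1 : (wireFns [] (sources n))[oneWire]? = some fun _ => true := by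
    rw [wireFns_sources]; rfl
  obtain ⟨h2, h3⟩ := cosa_spec (M := 2 * n + 1) (n := n) (l := 0) (w := 2 * n + 3)
    (c := cinWire) (cf := fun ρ => ρ 0) (fs := wireFns [] (sources n))
    (by rw [wireFns_length]; simp [sources]) h0 h1
    (fun i _ hi => wireFns_sources_var (by omega)) (fun i _ hi => wireFns_sources_var (by omega))
    (wireFns_sources_var (by omega)) (fun ρ τ h => h 0 rfl)
  refine ⟨(admissible_sources n).append h2, ?_⟩
  rw [cosaCircuit, wireFns_append]
  exact h3

theorem cosaCircuit_length_le (n : ℕ) :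
    (cosaCircuit n).length ≤ 6 * n ^ 3 + 2 * n + 3 := by
  have := (cosa_length n 0 (2 * n + 3) cinWire).2
  simp only [cosaCircuit, sources, cosaBlock, List.length_append, List.length_map,
    List.length_range, List.length_cons, List.length_nil]
  omega

end PolyAdd

/-! ### Assembly of the bounds. -/

theorem theorem3 :
    ∃ (p : Polynomial ℕ) (C : ℕ), ∀ n : ℕ, 1 ≤ n →
      ∃ (refs : List ℕ) (σ : PolyAdd.State),
        -- symbolic simulation succeeds, with a stack for `2n + 2` open calls of `ite`
        PolyAdd.simulate (2 * n + 2) (PolyAdd.cosaCircuit n) [] PolyAdd.State.empty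
          = some (refs, σ) ∧
        -- polynomial time and space
        σ.steps ≤ p.eval n ∧
        PolyAdd.spaceUsed (2 * n + 2) refs σ ≤ p.eval n ∧
        -- the result: reduced ordered BDDs of all signals, each of linear size
        PolyAdd.IsROBDD σ.nodes ∧
        refs.length = (PolyAdd.cosaCircuit n).length ∧
        (∀ k r : ℕ, refs[k]? = some r →
          PolyAdd.Represents σ.nodes r
            (fun ρ => (PolyAdd.wireValues ρ (PolyAdd.cosaCircuit n)).getD k false) ∧
          PolyAdd.bddSize σ.nodes r ≤ ((C * n : ℕ) : ℕ∞)) ∧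
        -- the outputs are the sum bits and the last carry bit of the adder function
        (PolyAdd.cosaBlock n).sum.length = n ∧
        (∀ i < n, ∃ w r : ℕ, (PolyAdd.cosaBlock n).sum[i]? = some w ∧ refs[w]? = some r ∧
          PolyAdd.Represents σ.nodes r (fun ρ => PolyAdd.sumBit ρ i)) ∧
        ∃ r : ℕ, refs[(PolyAdd.cosaBlock n).cout]? = some r ∧
          PolyAdd.Represents σ.nodes r (fun ρ => PolyAdd.carry ρ n) := by
  -- `G` bounds the number of gates and `K` the total number of activations for `2 * n + 1`
  -- variables. Each table has at most `K` entries, so the steps are at most `K * (2 * K + 5)`; the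
  -- other summands bound the space. The constant `26` comes from `8 * (2 * n + 1) + 2 ≤ 26 * n`,
  -- which uses `1 ≤ n`.
  let G : Polynomial ℕ := 6 * .X ^ 3 + 2 * .X + 3
  let K : Polynomial ℕ := G * (16 * (2 * .X + 1) + 31)
  refine ⟨K * (2 * K + 5) + 2 * K + G + (2 * .X + 2), 26, fun n hn => ?_⟩
  obtain ⟨hadm, hout⟩ := PolyAdd.cosaCircuit_spec n
  obtain ⟨refs, σ, e, hg, hrep, hnar, hcost⟩ := PolyAdd.simulate_spec (refs := [])
    (PolyAdd.Good.empty (2 * n + 1)) ⟨rfl, fun k r f h => by simp at h⟩ (by simp) hadm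
  have hlen : refs.length = (PolyAdd.cosaCircuit n).length := by
    rw [hrep.length_eq, PolyAdd.wireFns_length]; simp
  have hlen_le := PolyAdd.cosaCircuit_length_le n
  have hG : G.eval n = 6 * n ^ 3 + 2 * n + 3 := by simp [G]
  have hK : K.eval n = G.eval n * (16 * (2 * n + 1) + 31) := by simp [K]
  have hp : (K * (2 * K + 5) + 2 * K + G + (2 * .X + 2)).eval n =
      K.eval n * (2 * K.eval n + 5) + 2 * K.eval n + G.eval n + (2 * n + 2) := by simp
  have hc := hcost.mono (N' := K.eval n) (by rw [hK, hG]; gcongr)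
  have c₁ := hc.nodes_le
  have c₂ := hc.computed_le
  have c₃ := hc.steps_le
  simp only [PolyAdd.State.empty, List.length_nil, zero_add] at c₁ c₂ c₃
  have hsum : (PolyAdd.cosaBlock n).sum.length = n := (PolyAdd.cosa_length n 0 (2 * n + 3) PolyAdd.cinWire).1
  refine ⟨refs, σ, e, ?_, ?_, hg.robdd, hlen, ?_, hsum, ?_, ?_⟩
  · rw [hp]
    have : K.eval n * (σ.computed.length + σ.nodes.length + 5) ≤
        K.eval n * (2 * K.eval n + 5) := Nat.mul_le_mul_left _ (by omega)
    omega
  · rw [hp, PolyAdd.spaceUsed, hlen]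
    rw [← hG] at hlen_le
    have := Nat.zero_le (K.eval n * (2 * K.eval n + 5))
    omega
  · intro k r hr
    have hk : k < (PolyAdd.wireFns [] (PolyAdd.cosaCircuit n)).length := by
      rw [← hrep.length_eq]; exact (List.getElem?_eq_some_iff.1 hr).1
    have hf := List.getElem?_eq_getElem hk
    obtain ⟨hv, hval⟩ := hrep.rep k r _ hr hf
    constructor
    · rw [hg.robdd.represents_iff hv, hval]
      funext ρ
      rw [PolyAdd.wireValues_eq, PolyAdd.getD_map hf]
    · refine (hg.robdd.bddSize_le hg.vars hv ?_).trans ?_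
      · rw [hval]; exact hnar _ (List.getElem_mem hk)
      · exact_mod_cast (by omega : 8 * (2 * n + 1) + 2 ≤ 26 * n)
  · intro i hi
    obtain ⟨x, hx, hf⟩ := hout i hi.le
    obtain ⟨r, hr, hv, hval⟩ := hrep.exists_ref hf
    refine ⟨x, r, ?_, hr, ?_⟩
    · rwa [List.getElem?_append_left (by rw [hsum]; exact hi)] at hx
    · rw [hg.robdd.represents_iff hv, hval]
      funext ρ
      rw [PolyAdd.blockOut, if_pos hi, PolyAdd.blockSum_zero_eq]
  · obtain ⟨x, hx, hf⟩ := hout n le_rfl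
    obtain ⟨r, hr, hv, hval⟩ := hrep.exists_ref hf
    rw [PolyAdd.getElem?_concat_of_length hsum] at hx
    obtain rfl := Option.some.inj hx
    refine ⟨r, hr, ?_⟩
    rw [hg.robdd.represents_iff hv, hval]
    funext ρ
    rw [PolyAdd.blockOut, if_neg (lt_irrefl n), PolyAdd.blockCarry_zero_eq]
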